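/- **Setting.** Let $\mathbf{x}_1,\dots,\mathbf{x}_n\in\mathbb{R}^d$ be fixed and let $\mathbf{y}_1,\dots,\mathbf{y}_n$ be independent real random variables such that, for some $\sigma\ge 0$, $\mathbf{E}e^{t(\mathbf{y}_i-\mathbf{E}\mathbf{y}_i)}\le e^{\sigma^2t^2/2}$ for all $i$ and all $t\in\mathbb{R}$. Put $\hat A=\frac1n\sum_{i=1}^n\mathbf{x}_i\mathbf{x}_i^T$ and $a=(\sup_j\hat A_{j,j})^{1/2}$. For $\beta\in\mathbb{R}^d$ and $\alpha\ge0$ let $\mathrm{supp}_\alpha(\beta)=\{j:|\beta_j|>\alpha\}$, and let $r_k^{(p)}(\beta)$ be the $p$-norm of the $d-k$ smallest components (in absolute value) of $\beta$. **Quantities.** For a positive semidefinite $A\in\mathbb{R}^{d\times d}$ and $p\in[1,\infty]$, let $I,J$ range over the disjoint subsets of $\{1,\dots,d\}$ with $k$ and $\ell$ elements, and $\mathbf{v}\in\mathbb{R}^I$, $\mathbf{u}\in\mathbb{R}^J$ over the nonzero vectors; let $\mathbf{v}^{p-1}$ have the entries $|\mathbf{v}_j|^{p-1}\mathrm{sgn}(\mathbf{v}_j)$.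 Define $$\rho^{(p)}_{A,k}=\sup_{I,\mathbf{v}}\frac{\|A_{I,I}\mathbf{v}\|_p}{\|\mathbf{v}\|_p},\quad \mu^{(p)}_{A,k}=\inf_{I,\mathbf{v}}\frac{\|A_{I,I}\mathbf{v}\|_p}{\|\mathbf{v}\|_p},\quad \gamma^{(p)}_{A,k,\ell}=\sup_{I,J,\mathbf{u}}\frac{\|A_{I,I}^{-1}A_{I,J}\mathbf{u}\|_p}{\|\mathbf{u}\|_\infty},$$ $$\omega^{(p)}_{A,k}=\inf_{I,\mathbf{v}}\frac{\max(0,\mathbf{v}^TA_{I,I}\mathbf{v}^{p-1})}{\|\mathbf{v}\|_p^p},\qquad \pi^{(p)}_{A,k,\ell}=\sup_{I,J,\mathbf{v},\mathbf{u}}\frac{(\mathbf{v}^{p-1})^TA_{I,J}\mathbf{u}\,\|\mathbf{v}\|_p}{\max(0,\mathbf{v}^TA_{I,I}\mathbf{v}^{p-1})\,\|\mathbf{u}\|_\infty},$$ with values in $[0,\infty]$, where $c/0=\infty$ for $c>0$, $0/0=0$, and $\gamma^{(p)}_{A,k,\ell}=\infty$ if some $A_{I,I}$ is singular. For $p=\infty$,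 $\mathbf{v}^{p-1}$ stands for any of the vectors $\mathrm{sgn}(\mathbf{v}_j)\mathbf{e}_j$ with $|\mathbf{v}_j|=\|\mathbf{v}\|_\infty$ (the limiting directions as $p\to\infty$); the infimum and the supremum also run over these choices, and in $\omega^{(\infty)}$ the denominator is $\mathbf{v}^T\mathbf{v}^{p-1}=\|\mathbf{v}\|_\infty$. **Procedure.** For $\lambda>0$ and a threshold $\alpha$, let $\hat\beta$ be a minimizer over $\beta\in\mathbb{R}^d$ of $\frac1n\sum_{i=1}^n(\beta^T\mathbf{x}_i-\mathbf{y}_i)^2+\lambda\|\beta\|_1$, and let $\hat\beta'$ be a minimizer of $\frac1n\sum_{i=1}^n(\beta^T\mathbf{x}_i-\mathbf{y}_i)^2+\lambda\sum_{j\notin\mathrm{supp}_\alpha(\hat\beta)}|\beta_j|$. **Theorem 8.1.** Let $\bar\beta\in\mathbb{R}^d$ satisfy $\mathbf{E}\mathbf{y}_i=\bar\beta^T\mathbf{x}_i$ for all $i$ and have at most $s$ nonzero entries. Let $k=|\mathrm{supp}_\lambda(\bar\beta)|$, $q=|\mathrm{supp}_{1.5\alpha}(\bar\beta)|$ and $\delta\in(0,0.5)$.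 Then there is an event of probability larger than $1-2\delta$ on which the following holds for all integers $\ell\ge1$ with $(d-s)/2\ge\ell\ge s$, all $t\in(0,1)$, all $p\in[1,\infty]$ and all choices of the minimizers $\hat\beta,\hat\beta'$. If - $t\le 1-\pi^{(2)}_{\hat A,k+\ell,\ell}\,k^{0.5}/\ell$; - $0.5\alpha\ge\lambda\ge 4(2-t)t^{-1}\sigma a\sqrt{2\ln(2d/\delta)/n}$; - either $\omega^{(p)}_{\hat A,s+\ell}>0$ and $16\,(\alpha\,\omega^{(p)}_{\hat A,s+\ell})^{-1}s^{1/p}\lambda\le t\le 1-\pi^{(p)}_{\hat A,s+\ell,\ell}\,s^{1-1/p}/\ell$, or $\mu^{(p)}_{\hat A,s+\ell}>0$ and $16\,(\alpha\,\mu^{(p)}_{\hat A,s+\ell})^{-1}(s+\ell)^{1/p}\lambda\le t\le 1-\gamma^{(p)}_{\hat A,s+\ell,\ell}\,s^{1-1/p}/\ell$ (where the upper bounds on $t$ include that the respective $\pi$ or $\gamma$ is finite), then $$\|\hat\beta'-\bar\beta\|_2\le\frac{8}{t\mu^{(2)}_{\hat A,k+\ell}}\Big[5\rho^{(2)}_{\hat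 A,k+\ell}\,r_k^{(2)}(\bar\beta)+\sqrt{k-q}\,\lambda+a\sigma\big(1+\sqrt{20\ln(1/\delta)}\big)\sqrt{q/n}\Big]+8\,r_k^{(2)}(\bar\beta).$$ -/

import Mathlib

open MeasureTheory ProbabilityTheory
open scoped NNReal ENNReal Matrix

noncomputable section

namespace TwoStageLasso

/-- The `p`-norm of a finite real vector, `p ∈ [1, ∞]`. -/
def pnorm {ι : Type*} [Fintype ι] (p : ℝ≥0∞) (v : ι → ℝ) : ℝ := ‖WithLp.toLp p v‖

/-- The block `A_{I,J}` of a `d × d` matrix. -/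
def block {d : ℕ} (A : Matrix (Fin d) (Fin d) ℝ) (I J : Finset (Fin d)) : Matrix I J ℝ :=
  A.submatrix Subtype.val Subtype.val

/-- The vector `v^{p-1}` with entries `|v_j|^{p-1} sgn (v_j)`, for finite `p`. -/
def signedPow {ι : Type*} (p : ℝ≥0∞) (v : ι → ℝ) : ι → ℝ :=
  fun j => |v j| ^ (p.toReal - 1) * SignType.sign (v j)

/-- `w` is a version of `v^{p-1}`. For finite `p` this is the vector `signedPow p v`. For `p = ∞`
it is a limit point of the directions of `v^{r-1}`, for real `r → ∞`: the vector `sgn (v_j) e_j`,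
where `j` is a coordinate with `|v_j| = ‖v‖_∞`. (If several coordinates are maximal, each of them
is allowed; the infimum and the supremum below run over all of them. Both quotients below are
invariant under positive rescaling of `v^{p-1}`.) -/
def IsSignedPow {ι : Type*} [Fintype ι] [DecidableEq ι] (p : ℝ≥0∞) (v w : ι → ℝ) : Prop :=
  (p ≠ ∞ ∧ w = signedPow p v) ∨
    (p = ∞ ∧ ∃ j, |v j| = pnorm ∞ v ∧ w = Pi.single j (SignType.sign (v j) : ℝ))

/-- For finite `p ≥ 1`, `vᵀ v^{p-1} = ‖v‖_p^p`, which is the denominator in `omegaQ`. -/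
theorem dotProduct_signedPow {ι : Type*} [Fintype ι] {p : ℝ≥0∞} (hp : 1 ≤ p) (hp' : p ≠ ∞)
    (v : ι → ℝ) : v ⬝ᵥ signedPow p v = pnorm p v ^ p.toReal := by
  have h1 : 1 ≤ p.toReal := by
    simpa using (ENNReal.toReal_le_toReal ENNReal.one_ne_top hp').2 hp
  have h0 : 0 < p.toReal := by linarith
  unfold pnorm signedPow
  rw [PiLp.norm_eq_sum h0, ← Real.rpow_mul (Finset.sum_nonneg fun i _ => by positivity),
    one_div_mul_cancel h0.ne', Real.rpow_one]
  refine Finset.sum_congr rfl fun j _ => ?_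
  rw [Real.norm_eq_abs, mul_left_comm]
  rcases eq_or_ne (v j) 0 with h | h
  · simp [h, h0.ne']
  · have : v j * (SignType.sign (v j) : ℝ) = |v j| := by
      rw [mul_comm]; exact sign_mul_self (v j)
    rw [this, ← Real.rpow_add_one (abs_ne_zero.2 h)]
    simp

/-- For `p = ∞` the same denominator is `‖v‖_∞`. -/
theorem dotProduct_isSignedPow_top {ι : Type*} [Fintype ι] [DecidableEq ι] {v w : ι → ℝ}
    (h : IsSignedPow ∞ v w) : v ⬝ᵥ w = pnorm ∞ v := by
  rcases h with ⟨h, _⟩ | ⟨_, j, hj, rfl⟩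
  · exact absurd rfl h
  · rw [dotProduct_single, ← hj, mul_comm]
    exact sign_mul_self (v j)

/-! The quantities `ρ, μ, γ, ω, π` of a matrix `A`. The suprema and infima run over all index sets
`I` with `k` elements (and all `J` with `ℓ` elements disjoint from `I`) and over all vectors. They
take values in `[0, ∞]`; there `c / 0 = ∞` for `c > 0`, and `0 / 0 = 0`. -/

/-- `ρ_{A,k}^{(p)} = sup ‖A_{I,I} v‖_p / ‖v‖_p`. -/
def rhoQ {d : ℕ} (A : Matrix (Fin d) (Fin d) ℝ) (p : ℝ≥0∞) (k : ℕ) : ℝ≥0∞ :=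
  ⨆ (I : Finset (Fin d)) (_ : I.card = k) (v : I → ℝ) (_ : v ≠ 0),
    ENNReal.ofReal (pnorm p (block A I I *ᵥ v)) / ENNReal.ofReal (pnorm p v)

/-- `μ_{A,k}^{(p)} = inf ‖A_{I,I} v‖_p / ‖v‖_p`. -/
def muQ {d : ℕ} (A : Matrix (Fin d) (Fin d) ℝ) (p : ℝ≥0∞) (k : ℕ) : ℝ≥0∞ :=
  ⨅ (I : Finset (Fin d)) (_ : I.card = k) (v : I → ℝ) (_ : v ≠ 0),
    ENNReal.ofReal (pnorm p (block A I I *ᵥ v)) / ENNReal.ofReal (pnorm p v)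

/-- `γ_{A,k,ℓ}^{(p)} = sup ‖A_{I,I}⁻¹ A_{I,J} u‖_p / ‖u‖_∞`; it is infinite if some `A_{I,I}` is
not invertible. -/
def gammaQ {d : ℕ} (A : Matrix (Fin d) (Fin d) ℝ) (p : ℝ≥0∞) (k l : ℕ) : ℝ≥0∞ :=
  ⨆ (I : Finset (Fin d)) (J : Finset (Fin d)) (_ : I.card = k) (_ : J.card = l)
    (_ : Disjoint I J) (u : J → ℝ) (_ : u ≠ 0),
    open Classical in
    if IsUnit (block A I I).det then
      ENNReal.ofReal (pnorm p ((block A I I)⁻¹ *ᵥ (block A I J *ᵥ u))) /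
        ENNReal.ofReal (pnorm ∞ u)
    else ∞

/-- `ω_{A,k}^{(p)} = inf max (0, vᵀ A_{I,I} v^{p-1}) / ‖v‖_p^p`, where `‖v‖_p^p = vᵀ v^{p-1}`;
`ENNReal.ofReal` is the positive part. -/
def omegaQ {d : ℕ} (A : Matrix (Fin d) (Fin d) ℝ) (p : ℝ≥0∞) (k : ℕ) : ℝ≥0∞ :=
  ⨅ (I : Finset (Fin d)) (_ : I.card = k) (v : I → ℝ) (_ : v ≠ 0) (w : I → ℝ)
    (_ : IsSignedPow p v w),
    ENNReal.ofReal (max 0 (v ⬝ᵥ (block A I I *ᵥ w))) / ENNReal.ofReal (v ⬝ᵥ w)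

/-- `π_{A,k,ℓ}^{(p)} =
sup ((v^{p-1})ᵀ A_{I,J} u) ‖v‖_p / (max (0, vᵀ A_{I,I} v^{p-1}) ‖u‖_∞)`. Taking the positive part
of the numerator does not change the supremum, because `u` may be replaced by `-u`. -/
def piQ {d : ℕ} (A : Matrix (Fin d) (Fin d) ℝ) (p : ℝ≥0∞) (k l : ℕ) : ℝ≥0∞ :=
  ⨆ (I : Finset (Fin d)) (J : Finset (Fin d)) (_ : I.card = k) (_ : J.card = l)
    (_ : Disjoint I J) (v : I → ℝ) (_ : v ≠ 0) (u : J → ℝ) (_ : u ≠ 0) (w : I → ℝ)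
    (_ : IsSignedPow p v w),
    ENNReal.ofReal ((w ⬝ᵥ (block A I J *ᵥ u)) * pnorm p v) /
      ENNReal.ofReal (max 0 (v ⬝ᵥ (block A I I *ᵥ w)) * pnorm ∞ u)

/-- `supp_α(β) = {j : |β_j| > α}`. -/
def suppT {d : ℕ} (α : ℝ) (β : Fin d → ℝ) : Finset (Fin d) :=
  Finset.univ.filter fun j => α < |β j|

/-- `r_k^{(p)}(β)`: the `p`-norm of the `d - k` entries of `β` that remain when the entries are
listed by decreasing absolute value and the first `k` of them are deleted. -/
def tailNorm {d : ℕ} (p : ℝ≥0∞) (k : ℕ) (β : Fin d → ℝ) : ℝ :=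
  pnorm p fun j : Fin d =>
    if (j : ℕ) < k then 0 else β (Tuple.sort (fun i => -|β i|) j)

/-- The matrix `Â = (1/n) ∑ᵢ xᵢ xᵢᵀ`. -/
def gram {n d : ℕ} (x : Fin n → Fin d → ℝ) : Matrix (Fin d) (Fin d) ℝ :=
  (1 / (n : ℝ)) • ∑ i, Matrix.vecMulVec (x i) (x i)

/-- `a = (sup_j Â_{j,j})^{1/2}`. -/
def designScale {n d : ℕ} (x : Fin n → Fin d → ℝ) : ℝ := √(⨆ j, gram x j j)

/-- `(1/n) ∑ᵢ (βᵀ xᵢ - yᵢ)² + lam ∑_{j ∉ S} |β_j|`. -/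
def lassoObj {n d : ℕ} (x : Fin n → Fin d → ℝ) (y : Fin n → ℝ) (lam : ℝ) (S : Finset (Fin d))
    (β : Fin d → ℝ) : ℝ :=
  (1 / (n : ℝ)) * ∑ i, (β ⬝ᵥ x i - y i) ^ 2 + lam * ∑ j ∈ Sᶜ, |β j|

/-- `β` minimizes the least squares objective with `L₁` penalty on the coordinates outside `S`. -/
def IsLassoSol {n d : ℕ} (x : Fin n → Fin d → ℝ) (y : Fin n → ℝ) (lam : ℝ) (S : Finset (Fin d))
    (β : Fin d → ℝ) : Prop :=
  ∀ β' : Fin d → ℝ, lassoObj x y lam S β ≤ lassoObj x y lam S β'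

/-- `(β₁, β₂)` is an output of the two-stage selective penalization procedure: `β₁` solves the
Lasso, and `β₂` solves the Lasso in which the coordinates in `supp_α(β₁)` are not penalized. -/
def IsTwoStageSol {n d : ℕ} (x : Fin n → Fin d → ℝ) (y : Fin n → ℝ) (lam α : ℝ)
    (β₁ β₂ : Fin d → ℝ) : Prop :=
  IsLassoSol x y lam ∅ β₁ ∧ IsLassoSol x y lam (suppT α β₁) β₂

end TwoStageLasso

end

/-! Randomness enters only through the vector z = (1/n) ∑ᵢ (yᵢ - β̄ᵀxᵢ) xᵢ (`noise`). `exists_event`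
fixes one event on which the maximum norm of z and its Euclidean norm on the deterministic set Q₀ =
supp_{1.5α}(β̄) are both controlled. The rest is deterministic, so ℓ, t, p and the minimizers may be
chosen after the event.

A minimizer β with unpenalized set S satisfies Â(β - β̄) = z - (λ/2) g with a subgradient g that
vanishes on S (`IsLassoSol.exists_subgradient`). Since |z_j| ≤ tλ/(4(2-t)) ≤ λ/4, pairing this
identity with the error gives a cone condition: the L₁ mass of β off F ⊇ S is controlled by the
error on F and by β̄ off F (`IsLassoSol.cone`). Let J hold the ℓ largest remaining entries off F and
put I = F ∪ J. The entries off I are cut into blocks of size ℓ (`shelling`). With the bound on π or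
γ, the cone condition makes their interaction with I at most 1 - t/2 times the main term, up to a
contribution of β̄ off F. A fraction t/2 of the main term survives and is compared with the
right-hand side of the optimality identity.

For stage one, F has s elements and contains the support of β̄; the result is a maximum-norm error
of at most 3α/32 (`IsLassoSol.abs_sub_le`). Thresholding at α therefore gives Q₀ ⊆ S ⊆ supp_λ(β̄).

For stage two, F = supp_λ(β̄) (`IsLassoSol.pnorm_two_sub_le`). Coordinates in Q₀ are unpenalized and
cost only the noise, those in F \ Q₀ cost λ√(k-q), and those in J contribute with a favourable sign.
The part of β̄ off F enters through its 2-norm, weighted by ρ. -/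

namespace TwoStageLasso

/-! ### Sub-Gaussian tail bounds -/

/-- Gaussian mixing: `E exp (Z² / (4c)) ≤ √2` for a `c`-sub-Gaussian variable `Z`. -/
theorem lintegral_exp_sq_le {Ω : Type*} [MeasurableSpace Ω] {P : Measure Ω}
    [IsProbabilityMeasure P] {Z : Ω → ℝ} {c : ℝ≥0} (hc : 0 < c) (hZm : Measurable Z)
    (hZ : HasSubgaussianMGF Z c P) :
    ∫⁻ ω, ENNReal.ofReal (Real.exp (Z ω ^ 2 / (4 * c))) ∂P ≤ ENNReal.ofReal √2 := by
  have hc' : (0 : ℝ) < c := by exact_mod_cast hc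
  -- The choice θ² = 1/(2c) makes exp(z²/(4c)) the Gaussian average of exp(θzg); after the swap, the
  -- sub-Gaussian bound leaves exp(g²/4).
  set θ : ℝ := √(1 / (2 * c)) with hθ
  have hθ2 : θ ^ 2 = 1 / (2 * c) := Real.sq_sqrt (by positivity)
  have h1 : ∀ z : ℝ, ENNReal.ofReal (Real.exp (z ^ 2 / (4 * c))) =
      ∫⁻ g, ENNReal.ofReal (Real.exp (θ * z * g)) ∂(gaussianReal 0 1) := by
    intro z
    rw [← ofReal_integral_eq_lintegral_ofReal (integrable_exp_mul_gaussianReal _)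
      (Filter.Eventually.of_forall fun _ => (Real.exp_pos _).le)]
    have := congrFun (mgf_id_gaussianReal (μ := 0) (v := 1)) (θ * z)
    simp only [mgf, id] at this
    rw [this]
    congr 2
    simp only [NNReal.coe_one]
    rw [mul_pow, hθ2]
    field_simp
    ring
  have h2 : ∀ g : ℝ, ∫⁻ ω, ENNReal.ofReal (Real.exp (θ * Z ω * g)) ∂P ≤
      ENNReal.ofReal (Real.exp (g ^ 2 / 4)) := by
    intro g
    have e : ∀ ω, θ * Z ω * g = (θ * g) * Z ω := fun ω => by ring
    simp_rw [e]
    rw [← ofReal_integral_eq_lintegral_ofReal (hZ.integrable_exp_mul _)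
      (Filter.Eventually.of_forall fun _ => (Real.exp_pos _).le)]
    apply ENNReal.ofReal_le_ofReal
    refine (hZ.mgf_le (θ * g)).trans (le_of_eq ?_)
    rw [mul_pow, hθ2]
    congr 1
    field_simp
    ring
  have h3 : ∫⁻ g, ENNReal.ofReal (Real.exp (g ^ 2 / 4)) ∂(gaussianReal 0 1) =
      ENNReal.ofReal √2 := by
    rw [gaussianReal_of_var_ne_zero 0 one_ne_zero,
      lintegral_withDensity_eq_lintegral_mul _ (measurable_gaussianPDF 0 1) (by fun_prop)]
    -- The factor exp(g²/4) turns the N(0,1) density into √2 times the N(0,2) density.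
    have : ∀ g : ℝ, (gaussianPDF 0 1 * fun g => ENNReal.ofReal (Real.exp (g ^ 2 / 4))) g =
        ENNReal.ofReal √2 * gaussianPDF 0 2 g := by
      intro g
      simp only [Pi.mul_apply, gaussianPDF]
      rw [← ENNReal.ofReal_mul (gaussianPDFReal_nonneg _ _ _),
        ← ENNReal.ofReal_mul (Real.sqrt_nonneg _)]
      congr 1
      simp only [gaussianPDFReal, NNReal.coe_one, NNReal.coe_ofNat, sub_zero, mul_one]
      have hs : √(2 * Real.pi * 2) = √2 * √(2 * Real.pi) := by
        rw [mul_comm (2 * Real.pi) 2, Real.sqrt_mul (by norm_num)]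
      have he : Real.exp (-g ^ 2 / 2) * Real.exp (g ^ 2 / 4) = Real.exp (-g ^ 2 / (2 * 2)) := by
        rw [← Real.exp_add]
        congr 1
        ring
      rw [hs, mul_assoc, he]
      have : 0 < √(2 * Real.pi) := by positivity
      field_simp
    simp_rw [this]
    rw [lintegral_const_mul _ (measurable_gaussianPDF 0 2),
      lintegral_gaussianPDF_eq_one 0 two_ne_zero, mul_one]
  calc ∫⁻ ω, ENNReal.ofReal (Real.exp (Z ω ^ 2 / (4 * c))) ∂P
      = ∫⁻ ω, ∫⁻ g, ENNReal.ofReal (Real.exp (θ * Z ω * g)) ∂(gaussianReal 0 1) ∂P := by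
        simp_rw [h1]
    _ = ∫⁻ g, ∫⁻ ω, ENNReal.ofReal (Real.exp (θ * Z ω * g)) ∂P ∂(gaussianReal 0 1) := by
        apply lintegral_lintegral_swap
        apply Measurable.aemeasurable
        fun_prop
    _ ≤ ∫⁻ g, ENNReal.ofReal (Real.exp (g ^ 2 / 4)) ∂(gaussianReal 0 1) := lintegral_mono h2
    _ = _ := h3

/-- Tail bound for the Euclidean norm of a vector of (possibly dependent) sub-Gaussian variables. -/
theorem measure_sum_sq_gt_le {Ω : Type*} [MeasurableSpace Ω] {P : Measure Ω}
    [IsProbabilityMeasure P] {ι : Type*} (S : Finset ι) {Z : ι → Ω → ℝ} {c : ℝ≥0}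
    (hZm : ∀ j, Measurable (Z j)) (hZ : ∀ j, HasSubgaussianMGF (Z j) c P) (u : ℝ) :
    P {ω | S.card * c * u < ∑ j ∈ S, Z j ω ^ 2} ≤ ENNReal.ofReal (√2 * Real.exp (-(u / 4))) := by
  rcases S.eq_empty_or_nonempty with rfl | hS
  · simp
  rcases eq_or_ne c 0 with rfl | hc
  · have : ∀ᵐ ω ∂P, ∀ j ∈ S, Z j ω = 0 :=
      (Finset.eventually_all S).2 fun j _ => (hZ j).ae_eq_zero_of_hasSubgaussianMGF_zero
    have h0 : P {ω | (S.card : ℝ) * (0 : ℝ≥0) * u < ∑ j ∈ S, Z j ω ^ 2} = 0 := by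
      rw [← nonpos_iff_eq_zero]
      refine (measure_mono_ae (t := ∅) ?_).trans (by simp)
      filter_upwards [this] with ω hω h
      have h' : (S.card : ℝ) * (0 : ℝ≥0) * u < ∑ j ∈ S, Z j ω ^ 2 := h
      rw [Finset.sum_eq_zero fun j hj => by rw [hω j hj]; simp] at h'
      simp at h'
    rw [h0]
    exact zero_le
  have hc0 : 0 < c := pos_iff_ne_zero.2 hc
  have hc' : (0 : ℝ) < c := by exact_mod_cast hc0
  have hq : (0 : ℝ) < S.card := by exact_mod_cast hS.card_pos
  set f : Ω → ℝ≥0∞ := fun ω =>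
    ∑ j ∈ S, ENNReal.ofReal ((S.card : ℝ)⁻¹) * ENNReal.ofReal (Real.exp (Z j ω ^ 2 / (4 * c)))
  have hf : Measurable f := by
    apply Finset.measurable_sum
    intro j _
    have := hZm j
    fun_prop
  have hint : ∫⁻ ω, f ω ∂P ≤ ENNReal.ofReal √2 := by
    rw [lintegral_finsetSum _ fun j _ => by have := hZm j; fun_prop]
    calc _ ≤ ∑ j ∈ S, ENNReal.ofReal ((S.card : ℝ)⁻¹) * ENNReal.ofReal √2 := by
          refine Finset.sum_le_sum fun j _ => ?_
          rw [lintegral_const_mul _ (by have := hZm j; fun_prop)]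
          gcongr
          exact lintegral_exp_sq_le hc0 (hZm j) (hZ j)
      _ = ENNReal.ofReal √2 := by
          rw [Finset.sum_const, nsmul_eq_mul, ← mul_assoc, ← ENNReal.ofReal_natCast,
            ← ENNReal.ofReal_mul hq.le, mul_inv_cancel₀ hq.ne', ENNReal.ofReal_one, one_mul]
  have hsub : {ω | S.card * c * u < ∑ j ∈ S, Z j ω ^ 2} ⊆
      {ω | ENNReal.ofReal (Real.exp (u / 4)) ≤ f ω} := by
    intro ω hω
    simp only [Set.mem_ofPred_eq] at hω ⊢
    have hfe : f ω = ENNReal.ofReal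
        (∑ j ∈ S, (S.card : ℝ)⁻¹ * Real.exp (Z j ω ^ 2 / (4 * c))) := by
      rw [ENNReal.ofReal_sum_of_nonneg fun j _ => by positivity]
      exact Finset.sum_congr rfl fun j _ => (ENNReal.ofReal_mul (by positivity)).symm
    rw [hfe]
    apply ENNReal.ofReal_le_ofReal
    -- Jensen's inequality bounds the exponential of the average by the average of exponentials.
    -- Only marginal moments are used, so no independence of the coordinates is needed.
    have hJ := convexOn_exp.map_sum_le (t := S) (w := fun _ => (S.card : ℝ)⁻¹)
      (p := fun j => Z j ω ^ 2 / (4 * c)) (fun _ _ => by positivity)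
      (by simp [hq.ne']) (fun _ _ => Set.mem_univ _)
    simp only [smul_eq_mul] at hJ
    refine le_trans (Real.exp_le_exp.2 ?_) hJ
    rw [← Finset.mul_sum, ← Finset.sum_div]
    rw [inv_mul_eq_div, div_div, div_le_div_iff₀ (by norm_num) (by positivity)]
    nlinarith
  calc P _ ≤ P {ω | ENNReal.ofReal (Real.exp (u / 4)) ≤ f ω} := measure_mono hsub
    _ ≤ (∫⁻ ω, f ω ∂P) / ENNReal.ofReal (Real.exp (u / 4)) :=
        meas_ge_le_lintegral_div hf.aemeasurable (by simp [Real.exp_pos]) (by simp)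
    _ ≤ ENNReal.ofReal √2 / ENNReal.ofReal (Real.exp (u / 4)) := by gcongr
    _ = _ := by
        rw [← ENNReal.ofReal_div_of_pos (Real.exp_pos _), Real.exp_neg, div_eq_mul_inv]

/-- Two-sided Chernoff bound. -/
theorem measure_abs_gt_le {Ω : Type*} [MeasurableSpace Ω] {P : Measure Ω}
    [IsProbabilityMeasure P] {Z : Ω → ℝ} {c : ℝ≥0} (hZ : HasSubgaussianMGF Z c P)
    {u : ℝ} (hu : 0 ≤ u) :
    P.real {ω | √(2 * c * u) < |Z ω|} ≤ 2 * Real.exp (-u) := by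
  rcases eq_or_ne c 0 with rfl | hc
  · have h0 : P {ω | √(2 * (0 : ℝ≥0) * u) < |Z ω|} = 0 := by
      rw [← nonpos_iff_eq_zero]
      refine (measure_mono_ae (t := ∅) ?_).trans (by simp)
      filter_upwards [hZ.ae_eq_zero_of_hasSubgaussianMGF_zero] with ω hω h
      have h' : √(2 * (0 : ℝ≥0) * u) < |Z ω| := h
      simp [hω] at h'
    rw [measureReal_def, h0]
    simp [Real.exp_nonneg]
  have hc' : (0 : ℝ) < c := by exact_mod_cast pos_iff_ne_zero.2 hc
  have key : ∀ W : Ω → ℝ, HasSubgaussianMGF W c P →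
      P.real {ω | √(2 * c * u) ≤ W ω} ≤ Real.exp (-u) := by
    intro W hW
    refine (hW.measure_ge_le (Real.sqrt_nonneg _)).trans (le_of_eq ?_)
    rw [Real.sq_sqrt (by positivity)]
    congr 1
    field_simp
  calc P.real {ω | √(2 * c * u) < |Z ω|}
      ≤ P.real ({ω | √(2 * c * u) ≤ Z ω} ∪ {ω | √(2 * c * u) ≤ (-Z) ω}) := by
        apply measureReal_mono _ (measure_ne_top _ _)
        intro ω hω
        rcases lt_abs.1 (show √(2 * c * u) < |Z ω| from hω) with h | h
        · exact Or.inl h.le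
        · exact Or.inr h.le
    _ ≤ _ := measureReal_union_le _ _
    _ ≤ 2 * Real.exp (-u) := by
        have h1 := key _ hZ
        have h2 := key _ hZ.neg
        linarith

/-! ### The noise vector and the good event -/

/-- The correlation `(1/n) ∑ᵢ (yᵢ - βᵀ xᵢ) x_{i,j}` of the residuals with the `j`-th variable. -/
noncomputable def noise {n d : ℕ} (x : Fin n → Fin d → ℝ) (y : Fin n → ℝ) (β : Fin d → ℝ)
    (j : Fin d) : ℝ :=
  (1 / (n : ℝ)) * ∑ i, (y i - β ⬝ᵥ x i) * x i j

theorem gram_apply {n d : ℕ} (x : Fin n → Fin d → ℝ) (i j : Fin d) :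
    gram x i j = (1 / (n : ℝ)) * ∑ m, x m i * x m j := by
  simp [gram, Matrix.sum_apply, Matrix.vecMulVec_apply]

theorem gram_diag_le {n d : ℕ} (x : Fin n → Fin d → ℝ) (j : Fin d) :
    gram x j j ≤ designScale x ^ 2 := by
  have h : gram x j j ≤ ⨆ j, gram x j j :=
    le_ciSup (f := fun j => gram x j j) (Set.finite_range _).bddAbove j
  have h0 : 0 ≤ gram x j j := by
    rw [gram_apply]
    exact mul_nonneg (by positivity) (Finset.sum_nonneg fun m _ => mul_self_nonneg _)
  rwa [designScale, Real.sq_sqrt (h0.trans h)]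

theorem HasSubgaussianMGF.mono_param {Ω : Type*} [MeasurableSpace Ω] {P : Measure Ω} {Z : Ω → ℝ}
    {b c : ℝ≥0} (h : HasSubgaussianMGF Z b P) (hbc : b ≤ c) : HasSubgaussianMGF Z c P where
  integrable_exp_mul := h.integrable_exp_mul
  mgf_le t := (h.mgf_le t).trans (Real.exp_le_exp.2 (by gcongr))

/-- The variance proxies of the independent summands add up to σ² Â_{j,j}/n, which is at most
σ²a²/n. -/
theorem hasSubgaussianMGF_noise {Ω : Type*} [MeasurableSpace Ω] {P : Measure Ω}
    [IsProbabilityMeasure P] {n d : ℕ} (x : Fin n → Fin d → ℝ) {Y : Fin n → Ω → ℝ}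
    (hYindep : iIndepFun Y P) {σ : ℝ≥0}
    (hYsub : ∀ i, HasSubgaussianMGF (fun ω => Y i ω - ∫ ω', Y i ω' ∂P) (σ ^ 2) P)
    {βbar : Fin d → ℝ} (hmean : ∀ i, ∫ ω, Y i ω ∂P = βbar ⬝ᵥ x i) (j : Fin d) :
    HasSubgaussianMGF (fun ω => noise x (fun i => Y i ω) βbar j)
      (σ ^ 2 * (designScale x).toNNReal ^ 2 / n) P := by
  have h1 : iIndepFun (fun i ω => (1 / (n : ℝ) * x i j) * (Y i ω - ∫ ω', Y i ω' ∂P)) P :=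
    hYindep.comp (fun i z => (1 / (n : ℝ) * x i j) * (z - ∫ ω', Y i ω' ∂P))
      fun i => by fun_prop
  have h2 := HasSubgaussianMGF.sum_of_iIndepFun h1 (s := Finset.univ)
    (c := fun i => ((1 / (n : ℝ) * x i j) ^ 2).toNNReal * σ ^ 2) fun i _ => by
      rw [Real.toNNReal_of_nonneg (sq_nonneg _)]
      exact (hYsub i).const_mul (1 / (n : ℝ) * x i j)
  have h3 := HasSubgaussianMGF.mono_param h2 (c := σ ^ 2 * (designScale x).toNNReal ^ 2 / n) ?_
  · convert h3 using 2 with ω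
    rw [noise, Finset.mul_sum]
    refine Finset.sum_congr rfl fun i _ => ?_
    rw [hmean i]
    ring
  · rw [← NNReal.coe_le_coe]
    push_cast
    simp_rw [Real.coe_toNNReal _ (sq_nonneg _)]
    rw [Real.coe_toNNReal (designScale x) (Real.sqrt_nonneg _)]
    have hg := gram_diag_le x j
    rw [gram_apply] at hg
    have e : ∑ i, (1 / (n : ℝ) * x i j) ^ 2 * (σ : ℝ) ^ 2 =
        σ ^ 2 * (1 / (n : ℝ) * ∑ m, x m j * x m j) / n := by
      rw [Finset.mul_sum, Finset.mul_sum, Finset.sum_div]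
      refine Finset.sum_congr rfl fun i _ => ?_
      ring
    refine (le_of_eq e).trans ?_
    gcongr

/-- Two bad events are removed: a union bound over the coordinates costs at most δ, and the
Euclidean tail bound costs strictly less than δ, which makes the final inequality strict. The set
`S` has to be deterministic here; it will be the level set of β̄ at 1.5α. -/
theorem exists_event {Ω : Type*} [MeasurableSpace Ω] (P : Measure Ω) [IsProbabilityMeasure P]
    {n d : ℕ} (x : Fin n → Fin d → ℝ) (Y : Fin n → Ω → ℝ)
    (hYmeas : ∀ i, Measurable (Y i)) (hYindep : iIndepFun Y P) (σ : ℝ≥0)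
    (hYsub : ∀ i, HasSubgaussianMGF (fun ω => Y i ω - ∫ ω', Y i ω' ∂P) (σ ^ 2) P)
    (βbar : Fin d → ℝ) (hmean : ∀ i, ∫ ω, Y i ω ∂P = βbar ⬝ᵥ x i) (S : Finset (Fin d))
    {δ : ℝ} (hδ : 0 < δ) (hδ' : δ < 1 / 2) :
    ∃ E : Set Ω, MeasurableSet E ∧ 1 - 2 * δ < P.real E ∧ ∀ ω ∈ E,
      (∀ j, |noise x (fun i => Y i ω) βbar j| ≤
        σ * designScale x * √(2 * Real.log (2 * d / δ) / n)) ∧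
      √(∑ j ∈ S, noise x (fun i => Y i ω) βbar j ^ 2) ≤
        designScale x * σ * (1 + √(20 * Real.log (1 / δ))) * √((S.card : ℝ) / n) := by
  set Z : Fin d → Ω → ℝ := fun j ω => noise x (fun i => Y i ω) βbar j with hZdef
  set c : ℝ≥0 := σ ^ 2 * (designScale x).toNNReal ^ 2 / n with hc
  have ha : 0 ≤ designScale x := Real.sqrt_nonneg _
  have hcr : (c : ℝ) = σ ^ 2 * designScale x ^ 2 / n := by
    rw [hc]
    push_cast
    rw [Real.coe_toNNReal _ ha]
  have hZ : ∀ j, HasSubgaussianMGF (Z j) c P := fun j =>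
    hasSubgaussianMGF_noise x hYindep hYsub hmean j
  have hZm : ∀ j, Measurable (Z j) := fun j => by
    simp only [hZdef, noise]
    fun_prop
  have hL : Real.log 2 < Real.log (1 / δ) :=
    Real.log_lt_log (by norm_num) ((lt_div_iff₀ hδ).2 (by linarith))
  have hL0 : 0 < Real.log (1 / δ) := (Real.log_pos (by norm_num)).trans hL
  set L := Real.log (1 / δ) with hLdef
  set u : ℝ := (1 + √(20 * L)) ^ 2 with hu
  set v : ℝ := Real.log (2 * d / δ) with hv
  set B₁ : Set Ω := ⋃ j, {ω | √(2 * c * v) < |Z j ω|} with hB₁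
  set B₂ : Set Ω := {ω | S.card * c * u < ∑ j ∈ S, Z j ω ^ 2} with hB₂
  have hm₁ : MeasurableSet B₁ := MeasurableSet.iUnion fun j =>
    measurableSet_lt measurable_const ((hZm j).norm)
  have hm₂ : MeasurableSet B₂ := measurableSet_lt measurable_const (by fun_prop)
  have hp₁ : P.real B₁ ≤ δ := by
    rcases Nat.eq_zero_or_pos d with rfl | hd
    · have : B₁ = ∅ := by simp [hB₁]
      rw [this]
      simpa using hδ.le
    have hd1 : (1 : ℝ) ≤ d := by exact_mod_cast hd
    have hd0 : (0 : ℝ) < d := by linarith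
    have hv0 : 0 ≤ v := Real.log_nonneg ((one_le_div hδ).2 (by linarith))
    calc P.real B₁ ≤ ∑ j, P.real {ω | √(2 * c * v) < |Z j ω|} := measureReal_iUnion_fintype_le _
      _ ≤ ∑ _j : Fin d, 2 * Real.exp (-v) :=
          Finset.sum_le_sum fun j _ => measure_abs_gt_le (hZ j) hv0
      _ = δ := by
          rw [Real.exp_neg, hv, Real.exp_log (by positivity)]
          simp
          field_simp
  have hp₂ : P.real B₂ < δ := by
    have h := measure_sum_sq_gt_le S hZm hZ u
    have h' : P.real B₂ ≤ √2 * Real.exp (-(u / 4)) :=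
      ENNReal.toReal_le_of_le_ofReal (by positivity) h
    refine h'.trans_lt ?_
    have hs : √2 ≤ 2 := by
      rw [Real.sqrt_le_left (by norm_num)]
      norm_num
    -- With u ≥ 8L the tail √2 exp(-u/4) is at most √2 δ², which is below δ because δ < 1/2.
    have hu' : 8 * L ≤ u := by
      have := Real.sq_sqrt (show 0 ≤ 20 * L by positivity)
      have := Real.sqrt_nonneg (20 * L)
      nlinarith
    have he : Real.exp (-(u / 4)) ≤ Real.exp (-(2 * L)) := Real.exp_le_exp.2 (by linarith)
    have hδL : Real.exp (-(2 * L)) = δ ^ 2 := by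
      rw [show -(2 * L) = -L + -L by ring, Real.exp_add, hLdef, one_div, Real.log_inv, neg_neg,
        Real.exp_log hδ, sq]
    have : 0 < Real.exp (-(u / 4)) := Real.exp_pos _
    nlinarith
  refine ⟨(B₁ ∪ B₂)ᶜ, (hm₁.union hm₂).compl, ?_, ?_⟩
  · rw [probReal_compl_eq_one_sub (hm₁.union hm₂)]
    have := measureReal_union_le (μ := P) B₁ B₂
    linarith
  · intro ω hω
    rw [Set.compl_union] at hω
    obtain ⟨h1, h2⟩ := hω
    constructor
    · intro j
      have h1' : ¬ √(2 * c * v) < |Z j ω| := fun h => h1 (Set.mem_iUnion.2 ⟨j, h⟩)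
      refine (not_lt.1 h1').trans (le_of_eq ?_)
      rw [hcr, show 2 * ((σ : ℝ) ^ 2 * designScale x ^ 2 / n) * v =
        (σ * designScale x) ^ 2 * (2 * v / n) by ring, Real.sqrt_mul (sq_nonneg _),
        Real.sqrt_sq (by positivity)]
    · have h2' : ∑ j ∈ S, Z j ω ^ 2 ≤ S.card * c * u := not_lt.1 h2
      refine (Real.sqrt_le_sqrt h2').trans (le_of_eq ?_)
      rw [hcr, hu, show (S.card : ℝ) * ((σ : ℝ) ^ 2 * designScale x ^ 2 / n) *
        (1 + √(20 * L)) ^ 2 = (designScale x * σ * (1 + √(20 * L))) ^ 2 * (S.card / n) by ring,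
        Real.sqrt_mul (sq_nonneg _), Real.sqrt_sq (by positivity)]

/-! ### Optimality conditions and the cone condition -/

theorem nonneg_of_forall_quadratic_nonneg {m e : ℝ}
    (h : ∀ r : ℝ, 0 < r → r ≤ 1 → 0 ≤ m * r ^ 2 + r * e) : 0 ≤ e := by
  by_contra! he
  have hd : 0 < 2 * (|m| + 1) := by positivity
  have hr : 0 < min 1 (-e / (2 * (|m| + 1))) := lt_min one_pos (div_pos (by linarith) hd)
  have h1 := h _ hr (min_le_left _ _)
  set r := min 1 (-e / (2 * (|m| + 1))) with hrdef
  have h2 : r * (2 * (|m| + 1)) ≤ -e := (le_div_iff₀ hd).1 (min_le_right _ _)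
  have h3 : m * r ≤ |m| * r := mul_le_mul_of_nonneg_right (le_abs_self m) hr.le
  have h4 : 0 ≤ r * (m * r + e) := by linarith
  have h5 := nonneg_of_mul_nonneg_right h4 hr
  nlinarith

/-- First-order conditions for minimizing a univariate quadratic plus an absolute value. -/
theorem stationary_of_forall_nonneg {m b lam β : ℝ} (hlam : 0 ≤ lam)
    (h : ∀ τ : ℝ, 0 ≤ m * τ ^ 2 + 2 * b * τ + lam * (|β + τ| - |β|)) :
    |b| ≤ lam / 2 ∧ b * β = -(lam / 2 * |β|) := by
  constructor
  · rw [abs_le]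
    constructor
    · have := nonneg_of_forall_quadratic_nonneg (m := m) (e := 2 * b + lam) fun r hr _ => by
        have h1 := h r
        have h2 : |β + r| - |β| ≤ r := by
          have := abs_add_le β r
          rw [abs_of_pos hr] at this
          linarith
        nlinarith
      linarith
    · have := nonneg_of_forall_quadratic_nonneg (m := m) (e := -(2 * b) + lam) fun r hr _ => by
        have h1 := h (-r)
        have h2 : |β + -r| - |β| ≤ r := by
          have := abs_add_le β (-r)
          rw [abs_neg, abs_of_pos hr] at this
          linarith
        nlinarith
      linarith
  -- Moving by ±rβ scales |β| by exactly 1 ± r, so both signs of the first-order term are available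
  -- and complementary slackness becomes an equality.
  · have h1 := nonneg_of_forall_quadratic_nonneg (m := m * β ^ 2)
      (e := 2 * b * β + lam * |β|) fun r hr _ => by
        have h1 := h (r * β)
        have h2 : |β + r * β| = (1 + r) * |β| := by
          rw [show β + r * β = (1 + r) * β by ring, abs_mul, abs_of_pos (by linarith)]
        rw [h2] at h1
        linarith
    have h2 := nonneg_of_forall_quadratic_nonneg (m := m * β ^ 2)
      (e := -(2 * b * β + lam * |β|)) fun r hr hr1 => by
        have h1 := h (-(r * β))
        have h2 : |β + -(r * β)| = (1 - r) * |β| := by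
          rw [show β + -(r * β) = (1 - r) * β by ring, abs_mul, abs_of_nonneg (by linarith)]
        rw [h2] at h1
        linarith
    linarith

theorem gram_mulVec_apply {n d : ℕ} (x : Fin n → Fin d → ℝ) (v : Fin d → ℝ) (j : Fin d) :
    (gram x *ᵥ v) j = (1 / (n : ℝ)) * ∑ m, (v ⬝ᵥ x m) * x m j := by
  simp only [Matrix.mulVec, dotProduct, gram_apply, Finset.mul_sum, Finset.sum_mul]
  rw [Finset.sum_comm]
  exact Finset.sum_congr rfl fun i _ => Finset.sum_congr rfl fun j _ => by ring

theorem dotProduct_gram_mulVec {n d : ℕ} (x : Fin n → Fin d → ℝ) (u v : Fin d → ℝ) :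
    u ⬝ᵥ (gram x *ᵥ v) = (1 / (n : ℝ)) * ∑ m, (u ⬝ᵥ x m) * (v ⬝ᵥ x m) := by
  rw [dotProduct]
  simp only [gram_mulVec_apply, Finset.mul_sum]
  rw [Finset.sum_comm]
  refine Finset.sum_congr rfl fun i _ => ?_
  rw [show u ⬝ᵥ x i = ∑ j, u j * x i j from rfl, Finset.sum_mul, Finset.mul_sum]
  exact Finset.sum_congr rfl fun j _ => by ring

theorem gram_quadForm_nonneg {n d : ℕ} (x : Fin n → Fin d → ℝ) (v : Fin d → ℝ) :
    0 ≤ v ⬝ᵥ (gram x *ᵥ v) := by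
  rw [dotProduct_gram_mulVec]
  exact mul_nonneg (by positivity) (Finset.sum_nonneg fun _ _ => mul_self_nonneg _)

/-- The Cauchy–Schwarz inequality for the form of `gram x`. -/
theorem sq_dotProduct_gram_le {n d : ℕ} (x : Fin n → Fin d → ℝ) (u v : Fin d → ℝ) :
    (u ⬝ᵥ (gram x *ᵥ v)) ^ 2 ≤ (u ⬝ᵥ (gram x *ᵥ u)) * (v ⬝ᵥ (gram x *ᵥ v)) := by
  simp only [dotProduct_gram_mulVec]
  have := Finset.sum_mul_sq_le_sq_mul_sq Finset.univ (fun m => u ⬝ᵥ x m) (fun m => v ⬝ᵥ x m)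
  simp only [sq] at this ⊢
  calc _ = (1 / (n : ℝ)) * (1 / (n : ℝ)) *
        ((∑ m, (u ⬝ᵥ x m) * (v ⬝ᵥ x m)) * ∑ m, (u ⬝ᵥ x m) * (v ⬝ᵥ x m)) := by ring
    _ ≤ (1 / (n : ℝ)) * (1 / (n : ℝ)) *
        ((∑ m, (u ⬝ᵥ x m) * (u ⬝ᵥ x m)) * ∑ m, (v ⬝ᵥ x m) * (v ⬝ᵥ x m)) := by gcongr
    _ = _ := by ring

/-- Cauchy–Schwarz for the form, applied to Âv and v, bounds ‖Âv‖⁴ by a multiple of vᵀÂv. -/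
theorem gram_mulVec_eq_zero {n d : ℕ} {x : Fin n → Fin d → ℝ} {v : Fin d → ℝ}
    (h : v ⬝ᵥ (gram x *ᵥ v) = 0) : gram x *ᵥ v = 0 := by
  have h1 := sq_dotProduct_gram_le x (gram x *ᵥ v) v
  rw [h, mul_zero] at h1
  exact dotProduct_self_eq_zero.1 (pow_eq_zero_iff two_ne_zero |>.1 (le_antisymm h1 (sq_nonneg _)))

/-- The first-order conditions of the selectively penalized Lasso; `g` is a subgradient of
the penalty divided by `lam`. -/
theorem IsLassoSol.exists_subgradient {n d : ℕ} {x : Fin n → Fin d → ℝ} {y : Fin n → ℝ}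
    {lam : ℝ} {S : Finset (Fin d)} {β : Fin d → ℝ} (h : IsLassoSol x y lam S β) (hlam : 0 < lam)
    (βbar : Fin d → ℝ) :
    ∃ g : Fin d → ℝ, (∀ j ∈ S, g j = 0) ∧ (∀ j, |g j| ≤ 1) ∧ (∀ j ∉ S, g j * β j = |β j|) ∧
      ∀ j, (gram x *ᵥ (β - βbar)) j = noise x y βbar j - lam / 2 * g j := by
  set b : Fin d → ℝ := fun j => (gram x *ᵥ (β - βbar)) j - noise x y βbar j with hb
  have hb' : ∀ j, b j = (1 / (n : ℝ)) * ∑ i, (β ⬝ᵥ x i - y i) * x i j := by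
    intro j
    simp only [hb]
    rw [gram_mulVec_apply, noise, ← mul_sub, ← Finset.sum_sub_distrib]
    congr 1
    refine Finset.sum_congr rfl fun i _ => ?_
    rw [sub_dotProduct]
    ring
  -- Only one coordinate is perturbed at a time. Setting the weight to 0 on `S` treats penalized and
  -- unpenalized coordinates together; `b` is half the gradient of the squared loss.
  have hone : ∀ j, ∀ τ : ℝ, 0 ≤ gram x j j * τ ^ 2 + 2 * b j * τ +
      (if j ∈ S then 0 else lam) * (|β j + τ| - |β j|) := by
    intro j τ
    have h1 := h (β + Pi.single j τ)
    simp only [lassoObj] at h1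
    have h2 : (1 / (n : ℝ)) * ∑ i, ((β + Pi.single j τ) ⬝ᵥ x i - y i) ^ 2 =
        (1 / (n : ℝ)) * ∑ i, (β ⬝ᵥ x i - y i) ^ 2 + gram x j j * τ ^ 2 + 2 * b j * τ := by
      rw [hb', gram_apply]
      simp only [Finset.mul_sum, Finset.sum_mul]
      rw [← Finset.sum_add_distrib, ← Finset.sum_add_distrib]
      refine Finset.sum_congr rfl fun i _ => ?_
      rw [add_dotProduct, single_dotProduct]
      ring
    have h3 : lam * ∑ i ∈ Sᶜ, |(β + Pi.single j τ : Fin d → ℝ) i| = lam * ∑ i ∈ Sᶜ, |β i| +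
        (if j ∈ S then 0 else lam) * (|β j + τ| - |β j|) := by
      have h4 : ∀ i, |(β + Pi.single j τ : Fin d → ℝ) i| =
          |β i| + if i = j then |β j + τ| - |β j| else 0 := by
        intro i
        rcases eq_or_ne i j with rfl | hij
        · simp
        · simp [hij]
      simp_rw [h4]
      rw [Finset.sum_add_distrib, Finset.sum_ite_eq', mul_add]
      by_cases hj : j ∈ S <;> simp [hj]
    rw [h2, h3] at h1
    linarith
  have hstat : ∀ j, |b j| ≤ (if j ∈ S then 0 else lam) / 2 ∧
      b j * β j = -((if j ∈ S then 0 else lam) / 2 * |β j|) := fun j =>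
    stationary_of_forall_nonneg (by split_ifs <;> linarith) (hone j)
  refine ⟨fun j => -(2 / lam) * b j, ?_, ?_, ?_, ?_⟩
  · intro j hj
    have := (hstat j).1
    simp only [hj, if_true, zero_div, abs_nonpos_iff] at this
    simp [this]
  · intro j
    have h1 := (hstat j).1
    have h2 : |b j| ≤ lam / 2 := h1.trans (by split_ifs <;> linarith)
    rw [abs_mul, abs_neg, abs_of_pos (by positivity)]
    calc 2 / lam * |b j| ≤ 2 / lam * (lam / 2) := by gcongr
      _ = 1 := by field_simp
  · intro j hj
    have h1 := (hstat j).2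
    simp only [hj, if_false] at h1
    rw [mul_assoc, h1]
    field_simp
  · intro j
    simp only [hb]
    field_simp
    ring

/-- The cone condition: off `F`, the `L₁` norm of the solution is controlled. -/
theorem IsLassoSol.cone {n d : ℕ} {x : Fin n → Fin d → ℝ} {y : Fin n → ℝ}
    {lam : ℝ} {S : Finset (Fin d)} {β : Fin d → ℝ} (h : IsLassoSol x y lam S β) (hlam : 0 < lam)
    {βbar : Fin d → ℝ} {F : Finset (Fin d)} (hSF : S ⊆ F) {e t : ℝ}
    (he : ∀ j, |noise x y βbar j| ≤ e) (ht : 0 < t) (ht' : t < 1)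
    (het : 4 * (2 - t) * e ≤ t * lam) :
    (4 - 3 * t) * ∑ j ∈ Fᶜ, |β j| ≤
      (4 - t) * (∑ j ∈ F, |β j - βbar j| + ∑ j ∈ Fᶜ, |βbar j|) := by
  obtain ⟨g, -, hg1, hgβ, hKKT⟩ := h.exists_subgradient hlam βbar
  have h0 := gram_quadForm_nonneg x (β - βbar)
  set Δ := β - βbar with hΔ
  have hexp : Δ ⬝ᵥ (gram x *ᵥ Δ) =
      ∑ j ∈ F, Δ j * (noise x y βbar j - lam / 2 * g j) +
      ∑ j ∈ Fᶜ, Δ j * (noise x y βbar j - lam / 2 * g j) := by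
    rw [Finset.sum_add_sum_compl, dotProduct]
    exact Finset.sum_congr rfl fun j _ => by rw [hKKT]
  have hF : ∑ j ∈ F, Δ j * (noise x y βbar j - lam / 2 * g j) ≤
      (lam / 2 + e) * ∑ j ∈ F, |β j - βbar j| := by
    rw [Finset.mul_sum]
    refine Finset.sum_le_sum fun j _ => ?_
    have h1 : |noise x y βbar j - lam / 2 * g j| ≤ lam / 2 + e := by
      have h2 := abs_sub (noise x y βbar j) (lam / 2 * g j)
      rw [abs_mul, abs_of_pos (by positivity : 0 < lam / 2)] at h2
      have h3 := he j
      have h4 := hg1 j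
      nlinarith
    calc Δ j * (noise x y βbar j - lam / 2 * g j)
        ≤ |Δ j| * |noise x y βbar j - lam / 2 * g j| := by rw [← abs_mul]; exact le_abs_self _
      _ ≤ |Δ j| * (lam / 2 + e) := by gcongr
      _ = _ := by rw [mul_comm]; rfl
  have hG : ∑ j ∈ Fᶜ, Δ j * (noise x y βbar j - lam / 2 * g j) ≤
      (e - lam / 2) * ∑ j ∈ Fᶜ, |β j| + (lam / 2 + e) * ∑ j ∈ Fᶜ, |βbar j| := by
    rw [Finset.mul_sum, Finset.mul_sum, ← Finset.sum_add_distrib]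
    refine Finset.sum_le_sum fun j hj => ?_
    have hjS : j ∉ S := fun hjS => (Finset.mem_compl.1 hj) (hSF hjS)
    have h1 := hgβ j hjS
    have h2 : g j * βbar j ≤ |βbar j| := by
      calc g j * βbar j ≤ |g j| * |βbar j| := by rw [← abs_mul]; exact le_abs_self _
        _ ≤ 1 * |βbar j| := by gcongr; exact hg1 j
        _ = _ := one_mul _
    have h3 : (β j - βbar j) * noise x y βbar j ≤ (|β j| + |βbar j|) * e := by
      calc (β j - βbar j) * noise x y βbar j ≤ |β j - βbar j| * |noise x y βbar j| := by
            rw [← abs_mul]; exact le_abs_self _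
        _ ≤ (|β j| + |βbar j|) * e := by
            gcongr
            · exact abs_sub _ _
            · exact he j
    have h4 : Δ j = β j - βbar j := rfl
    rw [h4]
    nlinarith
  set T0 := ∑ j ∈ Fᶜ, |β j|
  set T1 := ∑ j ∈ F, |β j - βbar j| + ∑ j ∈ Fᶜ, |βbar j| with hT1
  have hT0 : 0 ≤ T0 := Finset.sum_nonneg fun _ _ => abs_nonneg _
  have hT1' : 0 ≤ T1 := add_nonneg (Finset.sum_nonneg fun _ _ => abs_nonneg _)
    (Finset.sum_nonneg fun _ _ => abs_nonneg _)
  -- Inserting the largest admissible e = tλ/(4(2-t)) gives the ratio (λ/2+e)/(λ/2-e) =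
  -- (4-t)/(4-3t), the constant of the cone condition.
  have hmain : (lam / 2 - e) * T0 ≤ (lam / 2 + e) * T1 := by
    rw [hexp] at h0
    rw [hT1]
    linarith
  have hm2 : 4 * (2 - t) * ((lam / 2) * (T0 - T1)) ≤ 4 * (2 - t) * e * (T0 + T1) := by
    have := mul_le_mul_of_nonneg_left (show lam / 2 * (T0 - T1) ≤ e * (T0 + T1) by linarith)
      (show 0 ≤ 4 * (2 - t) by linarith)
    linarith
  have hm3 : 4 * (2 - t) * e * (T0 + T1) ≤ t * lam * (T0 + T1) := by gcongr
  have hm4 : lam * ((4 - 3 * t) * T0) ≤ lam * ((4 - t) * T1) := by linarith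
  exact le_of_mul_le_mul_left hm4 hlam

/-! ### Shelling -/

/-- The restriction of a vector to an index set, extended by zero. -/
def cut {ι : Type*} [DecidableEq ι] (I : Finset ι) (v : ι → ℝ) : ι → ℝ :=
  fun j => if j ∈ I then v j else 0

theorem exists_top_subset {ι : Type*} [DecidableEq ι] (f : ι → ℝ) (G : Finset ι) :
    ∀ l ≤ G.card, ∃ J ⊆ G, J.card = l ∧ ∀ i ∈ J, ∀ j ∈ G \ J, f j ≤ f i := by
  intro l
  induction l with
  | zero => exact fun _ => ⟨∅, by simp, rfl, by simp⟩
  | succ l ih =>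
    intro hl
    obtain ⟨J, hJG, hJc, hJ⟩ := ih (by omega)
    have hne : (G \ J).Nonempty := by
      rw [← Finset.card_pos, Finset.card_sdiff_of_subset hJG]
      omega
    obtain ⟨m, hm, hmax⟩ := (G \ J).exists_max_image f hne
    have hm' := Finset.mem_sdiff.1 hm
    refine ⟨insert m J, Finset.insert_subset hm'.1 hJG, ?_, ?_⟩
    · rw [Finset.card_insert_of_notMem hm'.2, hJc]
    · intro i hi j hj
      have hj' : j ∈ G \ J := by
        simp only [Finset.mem_sdiff, Finset.mem_insert, not_or] at hj ⊢
        exact ⟨hj.1, hj.2.2⟩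
      rcases Finset.mem_insert.1 hi with rfl | hi
      · exact hmax j hj'
      · exact hJ i hi j hj'

/-- The shelling argument: a subadditive function that is at most `K M` at vectors which are
bounded by `M` and supported on `l` coordinates is at most `K ‖u‖₁ / l` at the part of `u` that
remains after the removal of its `l` largest entries. -/
theorem shelling {ι : Type*} [DecidableEq ι] (u : ι → ℝ) {l : ℕ} (hl : 1 ≤ l)
    (N : (ι → ℝ) → ℝ) (hadd : ∀ v w, N (v + w) ≤ N v + N w) {K : ℝ} (hK : 0 ≤ K) (I : Finset ι)
    (hN : ∀ (H : Finset ι) (v : ι → ℝ) (M : ℝ), H.card ≤ l → Disjoint I H →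
      (∀ j ∉ H, v j = 0) → 0 ≤ M → (∀ j, |v j| ≤ M) → N v ≤ K * M) :
    ∀ (m : ℕ) (J R : Finset ι), R.card = m → J.card = l → Disjoint I R →
      (∀ i ∈ J, ∀ j ∈ R, |u j| ≤ |u i|) →
      N (cut R u) ≤ K * ((∑ j ∈ J, |u j| + ∑ j ∈ R, |u j|) / l) := by
  have hl0 : (0 : ℝ) < l := by exact_mod_cast hl
  have hstep : ∀ (J R H : Finset ι), H ⊆ R → H.card ≤ l → J.card = l → Disjoint I R →
      (∀ i ∈ J, ∀ j ∈ R, |u j| ≤ |u i|) → N (cut H u) ≤ K * ((∑ j ∈ J, |u j|) / l) := by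
    intro J R H hHR hH hJ hIR hJR
    have hpos : 0 ≤ (∑ j ∈ J, |u j|) / l := by positivity
    refine hN H _ _ hH (hIR.mono_right hHR) (fun j hj => by simp [cut, hj]) hpos fun j => ?_
    by_cases hj : j ∈ H
    · simp only [cut, hj, if_true]
      rw [le_div_iff₀ hl0]
      have := Finset.card_nsmul_le_sum J (fun i => |u i|) |u j| fun i hi => hJR i hi j (hHR hj)
      rw [hJ, nsmul_eq_mul] at this
      linarith
    · simpa [cut, hj] using hpos
  intro m
  induction m using Nat.strong_induction_on with
  | _ m ih =>
    intro J R hR hJ hIR hJR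
    have hRnn : 0 ≤ ∑ j ∈ R, |u j| := Finset.sum_nonneg fun _ _ => abs_nonneg _
    by_cases hRl : R.card ≤ l
    · refine (hstep J R R subset_rfl hRl hJ hIR hJR).trans ?_
      gcongr
      linarith
    -- The next block `H` is paid for by the average over `J` and then takes over the role of `J`
    -- for the remainder. Each block's mass is thus used only once.
    · obtain ⟨H, hHR, hHc, hH⟩ := exists_top_subset (fun j => |u j|) R l (by omega)
      have hcut : cut R u = cut H u + cut (R \ H) u := by
        ext j
        simp only [cut, Pi.add_apply, Finset.mem_sdiff]
        by_cases h1 : j ∈ H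
        · simp [h1, hHR h1]
        · simp [h1]
      have h1 := hstep J R H hHR hHc.le hJ hIR hJR
      have h2 := ih (R \ H).card
        (by rw [Finset.card_sdiff_of_subset hHR]; omega) H (R \ H) rfl hHc
        (hIR.mono_right Finset.sdiff_subset) hH
      have h3 : ∑ j ∈ H, |u j| + ∑ j ∈ R \ H, |u j| = ∑ j ∈ R, |u j| := by
        rw [add_comm, Finset.sum_sdiff hHR]
      rw [h3] at h2
      calc N (cut R u) ≤ N (cut H u) + N (cut (R \ H) u) := by rw [hcut]; exact hadd _ _
        _ ≤ K * ((∑ j ∈ J, |u j|) / l) + K * ((∑ j ∈ R, |u j|) / l) := add_le_add h1 h2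
        _ = _ := by ring

/-! ### Signed powers, p-norms and Hölder's inequality -/

/-- The common sign structure for all p lets the subgradient beat the noise on the coordinates where
β̄ vanishes. -/
theorem IsSignedPow.exists_eq_mul_sign {ι : Type*} [Fintype ι] [DecidableEq ι] {p : ℝ≥0∞}
    {v w : ι → ℝ} (h : IsSignedPow p v w) :
    ∃ c : ι → ℝ, (∀ j, 0 ≤ c j) ∧ ∀ j, w j = c j * SignType.sign (v j) := by
  rcases h with ⟨_, rfl⟩ | ⟨_, i, _, rfl⟩
  · exact ⟨fun j => |v j| ^ (p.toReal - 1), fun j => by positivity, fun j => rfl⟩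
  · refine ⟨fun j => if j = i then 1 else 0, fun j => by positivity, fun j => ?_⟩
    rcases eq_or_ne j i with rfl | hj
    · simp
    · simp [hj]

section pnorm

variable {ι : Type*} [Fintype ι] {p : ℝ≥0∞} [Fact (1 ≤ p)]

theorem pnorm_nonneg (v : ι → ℝ) : 0 ≤ pnorm p v := norm_nonneg (WithLp.toLp p v)

theorem pnorm_add_le (v w : ι → ℝ) : pnorm p (v + w) ≤ pnorm p v + pnorm p w :=
  norm_add_le (WithLp.toLp p v) (WithLp.toLp p w)

theorem pnorm_neg (v : ι → ℝ) : pnorm p (-v) = pnorm p v := norm_neg (WithLp.toLp p v)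

theorem pnorm_zero : pnorm p (0 : ι → ℝ) = 0 := norm_zero (E := PiLp p fun _ : ι => ℝ)

theorem pnorm_pos {v : ι → ℝ} (hv : v ≠ 0) : 0 < pnorm p v :=
  norm_pos_iff.2 (show WithLp.toLp p v ≠ 0 by simpa using hv)

theorem abs_le_pnorm (v : ι → ℝ) (j : ι) : |v j| ≤ pnorm p v :=
  PiLp.norm_apply_le (WithLp.toLp p v) j

theorem pnorm_top_le {v : ι → ℝ} {M : ℝ} (hM : 0 ≤ M) (h : ∀ j, |v j| ≤ M) : pnorm ∞ v ≤ M :=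
  Real.iSup_le (fun j => h j) hM

theorem one_le_toReal (hp : p ≠ ∞) : 1 ≤ p.toReal := by
  simpa using (ENNReal.toReal_le_toReal ENNReal.one_ne_top hp).2 (Fact.out : 1 ≤ p)

theorem pnorm_eq_sum (hp : p ≠ ∞) (v : ι → ℝ) :
    pnorm p v = (∑ j, |v j| ^ p.toReal) ^ (1 / p.toReal) :=
  PiLp.norm_eq_sum (by linarith [one_le_toReal hp]) (WithLp.toLp p v)

theorem pnorm_le_card {v : ι → ℝ} {M : ℝ} (hM : 0 ≤ M) (h : ∀ j, |v j| ≤ M) :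
    pnorm p v ≤ (Fintype.card ι : ℝ) ^ (1 / p).toReal * M := by
  rcases eq_or_ne p ∞ with rfl | hp
  · simpa using pnorm_top_le hM h
  have hr := one_le_toReal hp
  have hr0 : 0 < p.toReal := by linarith
  rw [pnorm_eq_sum hp, ENNReal.toReal_div, ENNReal.toReal_one]
  calc (∑ j, |v j| ^ p.toReal) ^ (1 / p.toReal)
      ≤ (∑ _j : ι, M ^ p.toReal) ^ (1 / p.toReal) := by
        gcongr with j
        exact h j
    _ = _ := by
        rw [Finset.sum_const, nsmul_eq_mul, Real.mul_rpow (by positivity) (by positivity),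
          ← Real.rpow_mul hM, mul_one_div_cancel hr0.ne', Real.rpow_one, Finset.card_univ]

theorem sum_abs_le_pnorm (F : Finset ι) (v : ι → ℝ) :
    ∑ j ∈ F, |v j| ≤ (F.card : ℝ) ^ (1 - (1 / p).toReal) * pnorm p v := by
  rcases eq_or_ne p ∞ with rfl | hp
  · have := Finset.sum_le_card_nsmul F (fun j => |v j|) (pnorm ∞ v) fun j _ => abs_le_pnorm v j
    simpa using this
  have hr := one_le_toReal hp
  have hr0 : 0 < p.toReal := by linarith
  have h1 := Real.rpow_sum_le_const_mul_sum_rpow F (fun j => v j) hr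
  have h2 : ∑ j ∈ F, |v j| ^ p.toReal ≤ ∑ j, |v j| ^ p.toReal :=
    Finset.sum_le_univ_sum_of_nonneg fun j => by positivity
  have hS : 0 ≤ ∑ j ∈ F, |v j| := Finset.sum_nonneg fun _ _ => abs_nonneg _
  rw [pnorm_eq_sum hp, ENNReal.toReal_div, ENNReal.toReal_one]
  calc ∑ j ∈ F, |v j| = ((∑ j ∈ F, |v j|) ^ p.toReal) ^ (1 / p.toReal) := by
        rw [← Real.rpow_mul hS, mul_one_div_cancel hr0.ne', Real.rpow_one]
    _ ≤ ((F.card : ℝ) ^ (p.toReal - 1) * ∑ j, |v j| ^ p.toReal) ^ (1 / p.toReal) := by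
        gcongr
        exact h1.trans (by gcongr)
    _ = _ := by
        rw [Real.mul_rpow (by positivity) (by positivity), ← Real.rpow_mul (by positivity)]
        congr 2
        field_simp

variable [DecidableEq ι]

theorem exists_isSignedPow {v : ι → ℝ} (hv : v ≠ 0) : ∃ w, IsSignedPow p v w := by
  rcases eq_or_ne p ∞ with rfl | hp
  · obtain ⟨i, -⟩ := Function.ne_iff.1 hv
    have : Nonempty ι := ⟨i⟩
    obtain ⟨j, hj⟩ := exists_eq_ciSup_of_finite (f := fun j => |v j|)
    exact ⟨_, Or.inr ⟨rfl, j, hj, rfl⟩⟩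
  · exact ⟨_, Or.inl ⟨hp, rfl⟩⟩

theorem IsSignedPow.dotProduct_pos {v w : ι → ℝ} (h : IsSignedPow p v w) (hv : v ≠ 0) :
    0 < v ⬝ᵥ w := by
  rcases eq_or_ne p ∞ with rfl | hp
  · rw [dotProduct_isSignedPow_top h]
    exact pnorm_pos hv
  · rcases h with ⟨_, rfl⟩ | ⟨h, _⟩
    · rw [dotProduct_signedPow Fact.out hp]
      exact Real.rpow_pos_of_pos (pnorm_pos hv) _
    · exact absurd h hp

/-- Hölder's inequality for the signed power. -/
theorem IsSignedPow.sum_abs_mul_pnorm_le {v w : ι → ℝ} (h : IsSignedPow p v w) (F : Finset ι) :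
    (∑ j ∈ F, |w j|) * pnorm p v ≤ (F.card : ℝ) ^ (1 / p).toReal * (v ⬝ᵥ w) := by
  rcases eq_or_ne p ∞ with rfl | hp
  · rw [dotProduct_isSignedPow_top h]
    rcases h with ⟨h, _⟩ | ⟨_, i, _, rfl⟩
    · exact absurd rfl h
    simp only [ENNReal.div_top, ENNReal.toReal_zero, Real.rpow_zero]
    refine mul_le_mul_of_nonneg_right ?_ (pnorm_nonneg v)
    calc _ ≤ ∑ j, |(Pi.single i (SignType.sign (v i) : ℝ) : ι → ℝ) j| :=
          Finset.sum_le_univ_sum_of_nonneg fun j => abs_nonneg _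
      _ = |(SignType.sign (v i) : ℝ)| := by
          rw [Finset.sum_eq_single i (fun j _ hj => by simp [hj]) (by simp)]
          simp
      _ ≤ 1 := by
          rcases lt_trichotomy (v i) 0 with h | h | h <;> simp [h]
  rcases h with ⟨_, rfl⟩ | ⟨h, _⟩
  swap
  · exact absurd h hp
  have hr := one_le_toReal hp
  have hr0 : 0 < p.toReal := by linarith
  rw [dotProduct_signedPow Fact.out hp, ENNReal.toReal_div, ENNReal.toReal_one]
  have hw : ∀ j, |signedPow p v j| ≤ |v j| ^ (p.toReal - 1) := by
    intro j
    rw [signedPow, abs_mul, abs_of_nonneg (by positivity : 0 ≤ |v j| ^ (p.toReal - 1))]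
    refine mul_le_of_le_one_right (by positivity) ?_
    rcases lt_trichotomy (v j) 0 with h | h | h <;> simp [h]
  rcases (pnorm_nonneg (p := p) v).eq_or_lt with h0 | hpos
  · rw [← h0, mul_zero]
    positivity
  have key : ∑ j ∈ F, |v j| ^ (p.toReal - 1) ≤
      (F.card : ℝ) ^ (1 / p.toReal) * pnorm p v ^ (p.toReal - 1) := by
    -- For p = 1 the conjugate exponent is infinite, but the sum is then just the cardinality.
    rcases hr.eq_or_lt with h1 | h1
    · simp [← h1]
    have hc := Real.HolderConjugate.conjExponent h1
    have hH := Real.inner_le_Lp_mul_Lq F (fun _ => (1 : ℝ)) (fun j => |v j| ^ (p.toReal - 1)) hc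
    have hexp : (p.toReal - 1) * p.toReal.conjExponent = p.toReal := by
      rw [Real.conjExponent]
      field_simp [(by linarith : p.toReal - 1 ≠ 0)]
    have hpow : ∀ j, |(|v j| ^ (p.toReal - 1))| ^ p.toReal.conjExponent = |v j| ^ p.toReal := by
      intro j
      rw [abs_of_nonneg (by positivity), ← Real.rpow_mul (abs_nonneg _), hexp]
    simp only [one_mul, abs_one, Real.one_rpow, Finset.sum_const, nsmul_eq_mul, mul_one,
      hpow] at hH
    refine hH.trans ?_
    gcongr
    rw [pnorm_eq_sum hp, ← Real.rpow_mul (by positivity)]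
    have he2 : 1 / p.toReal * (p.toReal - 1) = 1 / p.toReal.conjExponent := by
      rw [Real.conjExponent]
      field_simp
    rw [he2]
    have : 0 ≤ 1 / p.toReal.conjExponent := by
      have := hc.symm.pos
      positivity
    gcongr
    exact Finset.subset_univ F
  calc (∑ j ∈ F, |signedPow p v j|) * pnorm p v
      ≤ (F.card : ℝ) ^ (1 / p.toReal) * pnorm p v ^ (p.toReal - 1) * pnorm p v := by
        refine mul_le_mul_of_nonneg_right (le_trans ?_ key) hpos.le
        exact Finset.sum_le_sum fun j _ => hw j
    _ = _ := by
        rw [mul_assoc, ← Real.rpow_add_one hpos.ne']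
        simp

end pnorm

/-! ### Real inequalities from the extremal quantities -/

/-- The case b = 0 is covered by the convention: a finite bound `c` on a/0 forces a ≤ 0. -/
theorem le_toReal_mul_of_div_le {a b : ℝ} {c : ℝ≥0∞} (hb : 0 ≤ b) (hc : c ≠ ∞)
    (h : ENNReal.ofReal a / ENNReal.ofReal b ≤ c) : a ≤ c.toReal * b := by
  rw [ENNReal.div_le_iff_le_mul (Or.inr hc) (Or.inl ENNReal.ofReal_ne_top),
    ← ENNReal.ofReal_toReal hc, ← ENNReal.ofReal_mul ENNReal.toReal_nonneg] at h
  exact (ENNReal.ofReal_le_ofReal_iff (mul_nonneg ENNReal.toReal_nonneg hb)).1 h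

theorem toReal_mul_le_of_le_div {a b : ℝ} {c : ℝ≥0∞} (ha : 0 ≤ a) (hb : 0 < b)
    (h : c ≤ ENNReal.ofReal a / ENNReal.ofReal b) : c ≠ ∞ ∧ c.toReal * b ≤ a := by
  rw [← ENNReal.ofReal_div_of_pos hb] at h
  refine ⟨ne_top_of_le_ne_top ENNReal.ofReal_ne_top h, ?_⟩
  have := ENNReal.toReal_le_of_le_ofReal (by positivity) h
  exact (le_div_iff₀ hb).1 this

section quantities

variable {d : ℕ} {A : Matrix (Fin d) (Fin d) ℝ} {p : ℝ≥0∞} {I J : Finset (Fin d)}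

theorem le_piQ_mul (h : piQ A p I.card J.card ≠ ∞) (hIJ : Disjoint I J) {v w : I → ℝ}
    (hv : v ≠ 0) (hw : IsSignedPow p v w) (u : J → ℝ) :
    (w ⬝ᵥ (block A I J *ᵥ u)) * pnorm p v ≤ (piQ A p I.card J.card).toReal *
      (max 0 (v ⬝ᵥ (block A I I *ᵥ w)) * pnorm ∞ u) := by
  have h0 : 0 ≤ max 0 (v ⬝ᵥ (block A I I *ᵥ w)) * pnorm ∞ u :=
    mul_nonneg (le_max_left _ _) (pnorm_nonneg _)
  rcases eq_or_ne u 0 with rfl | hu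
  · simp [pnorm_zero]
  · apply le_toReal_mul_of_div_le h0 h
    exact le_iSup₂_of_le I J (le_iSup₂_of_le rfl rfl (le_iSup₂_of_le hIJ v
      (le_iSup₂_of_le hv u (le_iSup₂_of_le hu w (le_iSup_of_le hw le_rfl)))))

variable [Fact (1 ≤ p)]

theorem omegaQ_ne_top_and_mul_le {v w : I → ℝ} (hv : v ≠ 0) (hw : IsSignedPow p v w) :
    omegaQ A p I.card ≠ ∞ ∧
      (omegaQ A p I.card).toReal * (v ⬝ᵥ w) ≤ max 0 (v ⬝ᵥ (block A I I *ᵥ w)) := by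
  apply toReal_mul_le_of_le_div (le_max_left _ _) (hw.dotProduct_pos hv)
  exact iInf₂_le_of_le I rfl (iInf₂_le_of_le v hv (iInf₂_le w hw))

theorem muQ_ne_top_and_mul_le {v : I → ℝ} (hv : v ≠ 0) :
    muQ A p I.card ≠ ∞ ∧
      (muQ A p I.card).toReal * pnorm p v ≤ pnorm p (block A I I *ᵥ v) := by
  apply toReal_mul_le_of_le_div (pnorm_nonneg _) (pnorm_pos hv)
  exact iInf₂_le_of_le I rfl (iInf₂_le v hv)

theorem muQ_mul_le (v : I → ℝ) :
    (muQ A p I.card).toReal * pnorm p v ≤ pnorm p (block A I I *ᵥ v) := by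
  rcases eq_or_ne v 0 with rfl | hv
  · simp [pnorm_zero]
  · exact (muQ_ne_top_and_mul_le hv).2

theorem le_rhoQ_mul (h : rhoQ A p I.card ≠ ∞) (v : I → ℝ) :
    pnorm p (block A I I *ᵥ v) ≤ (rhoQ A p I.card).toReal * pnorm p v := by
  rcases eq_or_ne v 0 with rfl | hv
  · simp [pnorm_zero]
  · apply le_toReal_mul_of_div_le (pnorm_nonneg _) h
    exact le_iSup₂_of_le I rfl (le_iSup₂_of_le v hv le_rfl)

theorem le_gammaQ_mul (h : gammaQ A p I.card J.card ≠ ∞) (hIJ : Disjoint I J) (u : J → ℝ) :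
    pnorm p ((block A I I)⁻¹ *ᵥ (block A I J *ᵥ u)) ≤
      (gammaQ A p I.card J.card).toReal * pnorm ∞ u := by
  rcases eq_or_ne u 0 with rfl | hu
  · simp [pnorm_zero]
  · have h1 : _ ≤ gammaQ A p I.card J.card :=
      le_iSup₂_of_le I J (le_iSup₂_of_le rfl rfl (le_iSup₂_of_le hIJ u (le_iSup_of_le hu le_rfl)))
    split_ifs at h1 with hdet
    · exact le_toReal_mul_of_div_le (pnorm_nonneg _) h h1
    · exact absurd (top_le_iff.1 h1) h

end quantities

/-! ### Restriction to index sets and scalar estimates -/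

/-- The vector of the entries with index in `I`. -/
def res {ι : Type*} (I : Finset ι) (v : ι → ℝ) : I → ℝ := fun i => v i

theorem res_add {ι : Type*} (I : Finset ι) (v w : ι → ℝ) : res I (v + w) = res I v + res I w := rfl

theorem cut_add_cut_compl {ι : Type*} [DecidableEq ι] [Fintype ι] (I : Finset ι) (v : ι → ℝ) :
    cut I v + cut Iᶜ v = v := by
  ext j
  by_cases h : j ∈ I <;> simp [cut, h]

theorem res_cut {ι : Type*} [DecidableEq ι] (I : Finset ι) (v : ι → ℝ) :
    res I (cut I v) = res I v := by
  ext j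
  simp [res, cut]

theorem block_mulVec_res {d : ℕ} (A : Matrix (Fin d) (Fin d) ℝ) (I J : Finset (Fin d))
    {v : Fin d → ℝ} (hv : ∀ j ∉ J, v j = 0) : block A I J *ᵥ res J v = res I (A *ᵥ v) := by
  ext i
  simp only [Matrix.mulVec, dotProduct, block, res, Matrix.submatrix_apply]
  rw [Finset.sum_coe_sort J (fun j => A i j * v j)]
  exact Finset.sum_subset (Finset.subset_univ _) fun j _ hj => by rw [hv j hj, mul_zero]

theorem res_dotProduct_res {ι : Type*} [Fintype ι] {I : Finset ι} {v : ι → ℝ}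
    (hv : ∀ j ∉ I, v j = 0) (w : ι → ℝ) : res I v ⬝ᵥ res I w = v ⬝ᵥ w := by
  simp only [dotProduct, res]
  rw [Finset.sum_coe_sort I (fun j => v j * w j)]
  exact Finset.sum_subset (Finset.subset_univ _) fun j _ hj => by rw [hv j hj, zero_mul]

theorem dotProduct_block_gram_comm {n d : ℕ} (x : Fin n → Fin d → ℝ) (I : Finset (Fin d))
    (v w : I → ℝ) : v ⬝ᵥ (block (gram x) I I *ᵥ w) = w ⬝ᵥ (block (gram x) I I *ᵥ v) := by
  have hsymm : (block (gram x) I I)ᵀ = block (gram x) I I := by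
    ext i j
    simp only [block, Matrix.transpose_apply, Matrix.submatrix_apply, gram_apply]
    simp_rw [mul_comm]
  rw [Matrix.dotProduct_mulVec, ← Matrix.mulVec_transpose, hsymm, dotProduct_comm]

/-- The `l` largest entries of `u` off `F`, and the bound from the shelling argument for the part of
`u` that is supported neither on `F` nor on these entries. -/
theorem exists_shelling {d : ℕ} (u : Fin d → ℝ) {l : ℕ} (hl : 1 ≤ l) (F : Finset (Fin d))
    (hF : F.card + 2 * l ≤ d) :
    ∃ J : Finset (Fin d), Disjoint F J ∧ J.card = l ∧
      (∀ i ∈ J, ∀ j ∈ (F ∪ J)ᶜ, |u j| ≤ |u i|) ∧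
      ∀ (N : (Fin d → ℝ) → ℝ) (K : ℝ), (∀ v w, N (v + w) ≤ N v + N w) → 0 ≤ K →
        (∀ (H : Finset (Fin d)) (v : Fin d → ℝ) (M : ℝ), H.card = l → Disjoint (F ∪ J) H →
          (∀ j ∉ H, v j = 0) → 0 ≤ M → (∀ j, |v j| ≤ M) → N v ≤ K * M) →
        N (cut (F ∪ J)ᶜ u) ≤ K * ((∑ j ∈ Fᶜ, |u j|) / l) := by
  have hFc : Fᶜ.card = d - F.card := by rw [Finset.card_compl, Fintype.card_fin]
  obtain ⟨J, hJF, hJc, hJ⟩ := exists_top_subset (fun j => |u j|) Fᶜ l (by omega)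
  have hR : (F ∪ J)ᶜ = Fᶜ \ J := by
    ext j
    simp
  have hdisj : Disjoint F J := by
    rw [Finset.disjoint_left]
    exact fun j hj hj' => Finset.mem_compl.1 (hJF hj') hj
  refine ⟨J, hdisj, hJc, by rwa [hR], fun N K hadd hK hN => ?_⟩
  have hsum : ∑ j ∈ J, |u j| + ∑ j ∈ (F ∪ J)ᶜ, |u j| = ∑ j ∈ Fᶜ, |u j| := by
    rw [hR, add_comm, Finset.sum_sdiff hJF]
  rw [← hsum]
  refine shelling u hl N hadd hK (F ∪ J) ?_ _ J _ rfl hJc disjoint_compl_right (by rwa [hR])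
  intro H v M hH hIH hv hM hvM
  -- The quantities π and γ range over sets with exactly ℓ elements. Since |F| + 2ℓ ≤ d, a shorter
  -- last block can be enlarged off F ∪ J.
  have hcard : l ≤ ((F ∪ J)ᶜ).card := by
    rw [Finset.card_compl, Fintype.card_fin, Finset.card_union_of_disjoint hdisj]
    omega
  have hHsub : H ⊆ (F ∪ J)ᶜ := fun j hj =>
    Finset.mem_compl.2 fun h => Finset.disjoint_left.1 hIH h hj
  obtain ⟨H', hHH', hH'sub, hH'c⟩ := Finset.exists_subsuperset_card_eq hHsub hH hcard
  refine hN H' v M hH'c ?_ (fun j hj => hv j fun h => hj (hHH' h)) hM hvM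
  rw [Finset.disjoint_left]
  exact fun j hj hj' => Finset.mem_compl.1 (hH'sub hj') hj

theorem sum_subtype_mem {ι : Type*} [DecidableEq ι] {F I : Finset ι} (hFI : F ⊆ I)
    (f : ι → ℝ) : ∑ i ∈ F.subtype (· ∈ I), f i = ∑ j ∈ F, f j := by
  rw [Finset.sum_subtype_of_mem f fun j hj => hFI hj]

theorem card_subtype_mem {ι : Type*} [DecidableEq ι] {F I : Finset ι} (hFI : F ⊆ I) :
    (F.subtype (· ∈ I)).card = F.card := by
  rw [Finset.card_subtype, Finset.filter_true_of_mem fun j hj => hFI hj]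

theorem le_quarter_of_le {e t lam : ℝ} (ht : 0 < t) (ht' : t < 1) (hlam : 0 < lam)
    (het : 4 * (2 - t) * e ≤ t * lam) : e ≤ lam / 4 := by
  have h1 : (2 - t) * (4 * e) ≤ (2 - t) * lam := by nlinarith
  have := le_of_mul_le_mul_left h1 (by linarith)
  linarith

/-- The loss from 1 - t to 1 - t/2 absorbs the cone constant: (4-t)(1-t) ≤ (4-3t)(1-t/2), with
difference t²/2. -/
theorem le_of_cone {t κ T V V' l π' : ℝ} (hl : 0 < l) (ht : 0 < t) (ht' : t < 1)
    (hV : 0 ≤ V) (hκ : 0 ≤ π') (hcone : (4 - 3 * t) * T ≤ (4 - t) * V') (hV' : V' ≤ κ * V)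
    (hc : t ≤ 1 - π' * κ / l) : π' * (T / l) ≤ (1 - t / 2) * V := by
  have h1 : (4 - 3 * t) * (π' * T) ≤ (4 - t) * (π' * (κ * V)) := by
    have := mul_le_mul_of_nonneg_left (hcone.trans
      (mul_le_mul_of_nonneg_left hV' (by linarith))) hκ
    linarith
  have h2 : π' * κ ≤ (1 - t) * l := (div_le_iff₀ hl).1 (by linarith)
  have h3 : π' * (κ * V) ≤ (1 - t) * l * V := by
    rw [← mul_assoc]
    gcongr
  have h4 : (4 - 3 * t) * (π' * T) ≤ (4 - 3 * t) * ((1 - t / 2) * V * l) := by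
    have h5 := mul_le_mul_of_nonneg_left h3 (show 0 ≤ 4 - t by linarith)
    have h6 : 0 ≤ t ^ 2 * (l * V) := by positivity
    nlinarith
  rw [← mul_div_assoc, div_le_iff₀ hl]
  exact le_of_mul_le_mul_left h4 (by linarith)

/-- The constant is 3/32 = (3/4)·2/16: the residual bound 3λ/4, the surviving fraction t/2, and the
factor 16 in the hypothesis. -/
theorem le_of_scaled_le {t α c V K lam : ℝ} (ht : 0 < t) (hα : 0 < α) (hc : 0 < c)
    (h1 : 16 * (α * c)⁻¹ * K * lam ≤ t) (h2 : c * (t / 2 * V) ≤ K * (3 / 4 * lam)) :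
    V ≤ 3 / 32 * α := by
  have h3 : 16 * K * lam ≤ t * (α * c) := by
    rw [← div_le_iff₀ (by positivity)]
    calc _ = 16 * (α * c)⁻¹ * K * lam := by field_simp
      _ ≤ t := h1
  have h4 : c * t * V ≤ c * t * (3 / 32 * α) := by nlinarith
  exact le_of_mul_le_mul_left h4 (by positivity)

/-! ### Stage one: maximum-norm error -/

/-- Estimation error of the Lasso in the maximum norm. -/
theorem IsLassoSol.abs_sub_le {n d : ℕ} {x : Fin n → Fin d → ℝ} {y : Fin n → ℝ}
    {lam α : ℝ} {β : Fin d → ℝ} (h : IsLassoSol x y lam ∅ β) (hlam : 0 < lam) (hα : 0 < α)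
    {βbar : Fin d → ℝ} {F : Finset (Fin d)} (hF : ∀ j ∉ F, βbar j = 0) {e t : ℝ}
    (he : ∀ j, |noise x y βbar j| ≤ e) (ht : 0 < t) (ht' : t < 1)
    (het : 4 * (2 - t) * e ≤ t * lam) {l : ℕ} (hl : 1 ≤ l) (hd : F.card + 2 * l ≤ d)
    {p : ℝ≥0∞} (hp : 1 ≤ p)
    (hcond : (0 < omegaQ (gram x) p (F.card + l) ∧ piQ (gram x) p (F.card + l) l ≠ ∞ ∧
        16 * (α * (omegaQ (gram x) p (F.card + l)).toReal)⁻¹ *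
          (F.card : ℝ) ^ (1 / p).toReal * lam ≤ t ∧
        t ≤ 1 - (piQ (gram x) p (F.card + l) l).toReal *
          (F.card : ℝ) ^ (1 - (1 / p).toReal) / l) ∨
      (0 < muQ (gram x) p (F.card + l) ∧ gammaQ (gram x) p (F.card + l) l ≠ ∞ ∧
        16 * (α * (muQ (gram x) p (F.card + l)).toReal)⁻¹ *
          ((F.card : ℝ) + l) ^ (1 / p).toReal * lam ≤ t ∧
        t ≤ 1 - (gammaQ (gram x) p (F.card + l) l).toReal *
          (F.card : ℝ) ^ (1 - (1 / p).toReal) / l)) (j : Fin d) :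
    |β j - βbar j| ≤ 3 / 32 * α := by
  have : Fact (1 ≤ p) := ⟨hp⟩
  have hl0 : (0 : ℝ) < l := by exact_mod_cast hl
  have hcone := h.cone hlam (Finset.empty_subset F) he ht ht' het
  obtain ⟨g, -, hg1, hgβ, hKKT⟩ := h.exists_subgradient hlam βbar
  have he4 := le_quarter_of_le ht ht' hlam het
  set Δ := β - βbar with hΔ
  obtain ⟨J, hFJ, hJc, hJ, hshell⟩ := exists_shelling Δ hl F hd
  set I := F ∪ J with hI
  have hFI : F ⊆ I := Finset.subset_union_left
  have hIc : I.card = F.card + l := by rw [hI, Finset.card_union_of_disjoint hFJ, hJc]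
  rw [Finset.sum_eq_zero (s := Fᶜ) (f := fun j => |βbar j|)
    fun j hj => by rw [hF j (Finset.mem_compl.1 hj), abs_zero], add_zero] at hcone
  have hΔF : ∀ j ∉ F, Δ j = β j := fun j hj => by simp [hΔ, hF j hj]
  have hT : ∑ j ∈ Fᶜ, |β j| = ∑ j ∈ Fᶜ, |Δ j| :=
    Finset.sum_congr rfl fun j hj => by rw [hΔF j (Finset.mem_compl.1 hj)]
  rw [hT] at hcone
  set v := res I Δ with hv
  have hvF : ∑ j ∈ F, |β j - βbar j| ≤ (F.card : ℝ) ^ (1 - (1 / p).toReal) * pnorm p v := by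
    have := sum_abs_le_pnorm (p := p) (F.subtype (· ∈ I)) v
    rw [card_subtype_mem hFI] at this
    refine le_trans (le_of_eq ?_) this
    exact (sum_subtype_mem hFI fun j => |Δ j|).symm
  have hr : ∀ j, |noise x y βbar j - lam / 2 * g j| ≤ 3 / 4 * lam := by
    intro j
    have h2 := abs_sub (noise x y βbar j) (lam / 2 * g j)
    rw [abs_mul, abs_of_pos (by positivity : 0 < lam / 2)] at h2
    have h3 := he j
    have h4 := hg1 j
    nlinarith
  have hsplit : res I (gram x *ᵥ Δ) =
      block (gram x) I I *ᵥ v + res I (gram x *ᵥ cut Iᶜ Δ) := by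
    have h1 : gram x *ᵥ Δ = gram x *ᵥ cut I Δ + gram x *ᵥ cut Iᶜ Δ := by
      rw [← Matrix.mulVec_add, cut_add_cut_compl]
    have h2 := block_mulVec_res (gram x) I I (v := cut I Δ) fun j hj => by simp [cut, hj]
    rw [h1, res_add, ← h2, res_cut]
  have hblock : ∀ (H : Finset (Fin d)) (z : Fin d → ℝ), (∀ j ∉ H, z j = 0) →
      res I (gram x *ᵥ z) = block (gram x) I H *ᵥ res H z := fun H z hz =>
    (block_mulVec_res (gram x) I H hz).symm
  -- Every entry off `I` is dominated by the entries on the nonempty set `J`, so the p-norm on `I`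
  -- controls all coordinates.
  suffices hmain : pnorm p v ≤ 3 / 32 * α by
    by_cases hj : j ∈ I
    · exact (abs_le_pnorm (p := p) v ⟨j, hj⟩).trans hmain
    · obtain ⟨i, hi⟩ := Finset.card_pos.1 (by omega : 0 < J.card)
      have h1 := hJ i hi j (Finset.mem_compl.2 hj)
      have h2 := abs_le_pnorm (p := p) v ⟨i, Finset.mem_union_right F hi⟩
      exact (h1.trans h2).trans hmain
  rcases eq_or_ne v 0 with hv0 | hv0
  · rw [hv0, pnorm_zero]
    positivity
  have hvpos := pnorm_pos (p := p) hv0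
  rcases hcond with ⟨hω, hπ, hα16, hπt⟩ | ⟨hμ, hγ, hα16, hγt⟩
  · obtain ⟨w, hw⟩ := exists_isSignedPow (p := p) hv0
    have hωw := omegaQ_ne_top_and_mul_le (A := gram x) hv0 hw
    rw [hIc] at hωw
    have hωpos := ENNReal.toReal_pos hω.ne' hωw.1
    set ω := (omegaQ (gram x) p (F.card + l)).toReal
    set π' := (piQ (gram x) p (F.card + l) l).toReal with hπ'
    have hW := hw.dotProduct_pos hv0
    set Q := v ⬝ᵥ (block (gram x) I I *ᵥ w) with hQ
    have hQmax : max 0 Q = Q := by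
      -- Positivity of ω excludes a negative main term.
      apply max_eq_right
      by_contra! hneg
      rw [max_eq_left hneg.le] at hωw
      have := mul_pos hωpos hW
      linarith [hωw.2]
    rw [hQmax] at hωw
    have hQ0 : 0 < Q := (mul_pos hωpos hW).trans_le hωw.2
    have hcross := hshell (fun z => -(w ⬝ᵥ res I (gram x *ᵥ z))) (π' * Q / pnorm p v)
      (fun z z' => by
        rw [Matrix.mulVec_add, res_add, dotProduct_add]
        linarith)
      (by positivity)
      (fun H z M hH hIH hz hM hzM => by
        have h1 := le_piQ_mul (A := gram x) (I := I) (J := H) (by rwa [hIc, hH]) hIH hv0 hw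
          (res H (-z))
        rw [hIc, hH, hQmax, ← hblock H (-z) (fun j hj => by simp [hz j hj]), Matrix.mulVec_neg,
          show res I (-(gram x *ᵥ z)) = -res I (gram x *ᵥ z) from rfl, dotProduct_neg] at h1
        have h2 : pnorm ∞ (res H (-z)) ≤ M := pnorm_top_le hM fun j => by
          simpa [res] using hzM j
        rw [div_mul_eq_mul_div, le_div_iff₀ hvpos]
        refine h1.trans ?_
        rw [mul_assoc]
        gcongr)
    have hlow : w ⬝ᵥ res I (gram x *ᵥ Δ) = Q + w ⬝ᵥ res I (gram x *ᵥ cut Iᶜ Δ) := by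
      rw [hsplit, dotProduct_add, hQ, dotProduct_block_gram_comm]
    have hup : w ⬝ᵥ res I (gram x *ᵥ Δ) ≤ 3 / 4 * lam * ∑ i ∈ F.subtype (· ∈ I), |w i| := by
      obtain ⟨c, hc0, hcw⟩ := hw.exists_eq_mul_sign
      rw [dotProduct, ← Finset.sum_add_sum_compl (F.subtype (· ∈ I)), Finset.mul_sum]
      -- Off `F` the error equals β, so `w`, β and `g` have matching signs where β ≠ 0. There λ/2
      -- beats the noise, which is at most λ/4. Thus only the coordinates of `F` count, and the
      -- factor is s^{1/p}; the μ, γ alternative lacks this sign argument and pays (s+ℓ)^{1/p}.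
      have h2 : ∑ i ∈ (F.subtype (· ∈ I))ᶜ, w i * res I (gram x *ᵥ Δ) i ≤ 0 := by
        refine Finset.sum_nonpos fun i hi => ?_
        have hiF : (i : Fin d) ∉ F := by simpa using hi
        have hval : res I (gram x *ᵥ Δ) i = noise x y βbar i - lam / 2 * g i := hKKT i
        have hvi : v i = β i := hΔF i hiF
        have hgi := hgβ i (Finset.notMem_empty _)
        have hei := abs_le.1 (he i)
        have hgi1 := hg1 i
        rw [hcw i, hval, hvi]
        rcases lt_trichotomy (β i) 0 with hb | hb | hb
        · rw [abs_of_neg hb] at hgi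
          have : g i = -1 := mul_right_cancel₀ hb.ne (by linarith)
          rw [sign_neg hb, this]
          have := hc0 i
          simp only [SignType.coe_neg_one]
          nlinarith
        · simp [hb]
        · rw [abs_of_pos hb] at hgi
          have : g i = 1 := mul_right_cancel₀ hb.ne' (by linarith)
          rw [sign_pos hb, this]
          have := hc0 i
          simp only [SignType.coe_one]
          nlinarith
      have h1 : ∑ i ∈ F.subtype (· ∈ I), w i * res I (gram x *ᵥ Δ) i ≤
          ∑ i ∈ F.subtype (· ∈ I), 3 / 4 * lam * |w i| := by
        refine Finset.sum_le_sum fun i _ => ?_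
        have hval : res I (gram x *ᵥ Δ) i = noise x y βbar i - lam / 2 * g i := hKKT i
        rw [hval]
        calc _ ≤ |w i| * |noise x y βbar i - lam / 2 * g i| := by
              rw [← abs_mul]; exact le_abs_self _
          _ ≤ |w i| * (3 / 4 * lam) := by gcongr; exact hr _
          _ = _ := mul_comm _ _
      linarith
    have hHold := hw.sum_abs_mul_pnorm_le (F.subtype (· ∈ I))
    rw [card_subtype_mem hFI] at hHold
    have hb := le_of_cone hl0 ht ht' hvpos.le ENNReal.toReal_nonneg hcone hvF hπt
    have hcross' : -(w ⬝ᵥ res I (gram x *ᵥ cut Iᶜ Δ)) ≤ (1 - t / 2) * Q := by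
      refine hcross.trans ?_
      rw [div_mul_eq_mul_div, div_le_iff₀ hvpos]
      calc π' * Q * ((∑ j ∈ Fᶜ, |Δ j|) / l) = Q * (π' * ((∑ j ∈ Fᶜ, |Δ j|) / l)) := by ring
        _ ≤ Q * ((1 - t / 2) * pnorm p v) := by gcongr
        _ = _ := by ring
    apply le_of_scaled_le ht hα hωpos hα16
    have h5 : t / 2 * Q ≤ 3 / 4 * lam * ∑ i ∈ F.subtype (· ∈ I), |w i| := by linarith
    have h6 : t / 2 * Q * pnorm p v ≤
        3 / 4 * lam * ((F.card : ℝ) ^ (1 / p).toReal * (v ⬝ᵥ w)) := by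
      calc _ ≤ (3 / 4 * lam * ∑ i ∈ F.subtype (· ∈ I), |w i|) * pnorm p v := by gcongr
        _ = 3 / 4 * lam * ((∑ i ∈ F.subtype (· ∈ I), |w i|) * pnorm p v) := by ring
        _ ≤ _ := by gcongr
    have h7 : t / 2 * (ω * (v ⬝ᵥ w)) * pnorm p v ≤ t / 2 * Q * pnorm p v := by
      gcongr
      exact hωw.2
    refine le_of_mul_le_mul_right (a := v ⬝ᵥ w) ?_ hW
    linarith
  · have hμv := muQ_ne_top_and_mul_le (A := gram x) (p := p) hv0
    have hμle := muQ_mul_le (A := gram x) (p := p) (I := I)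
    rw [hIc] at hμv hμle
    have hμpos := ENNReal.toReal_pos hμ.ne' hμv.1
    set μ' := (muQ (gram x) p (F.card + l)).toReal
    set B := block (gram x) I I with hB
    have hinj : Function.Injective B.mulVec := by
      intro z z' hzz
      by_contra hne
      have h1 := hμle (z - z')
      rw [Matrix.mulVec_sub, show B *ᵥ z = B *ᵥ z' from hzz, sub_self, pnorm_zero] at h1
      have := mul_pos hμpos (pnorm_pos (p := p) (sub_ne_zero.2 hne))
      linarith
    have hdet : IsUnit B.det :=
      (Matrix.isUnit_iff_isUnit_det B).1 (Matrix.mulVec_injective_iff_isUnit.1 hinj)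
    have hcross := hshell (fun z => pnorm p (B⁻¹ *ᵥ res I (gram x *ᵥ z)))
      (gammaQ (gram x) p (F.card + l) l).toReal
      (fun z z' => by
        rw [Matrix.mulVec_add, res_add, Matrix.mulVec_add]
        exact pnorm_add_le _ _)
      ENNReal.toReal_nonneg
      (fun H z M hH hIH hz hM hzM => by
        have h1 := le_gammaQ_mul (A := gram x) (p := p) (I := I) (J := H) (by rwa [hIc, hH]) hIH
          (res H z)
        rw [hIc, hH, ← hblock H z hz] at h1
        refine h1.trans ?_
        have h2 : pnorm ∞ (res H z) ≤ M := pnorm_top_le hM fun j => hzM j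
        exact mul_le_mul_of_nonneg_left h2 ENNReal.toReal_nonneg)
    have hb := le_of_cone hl0 ht ht' hvpos.le ENNReal.toReal_nonneg hcone hvF hγt
    -- Solving the block equation for `v` replaces the test vector: γ bounds the contribution from
    -- off `I`, and μ bounds the inverse applied to the residual.
    have hveq : v = B⁻¹ *ᵥ res I (gram x *ᵥ Δ) + -(B⁻¹ *ᵥ res I (gram x *ᵥ cut Iᶜ Δ)) := by
      rw [hsplit, Matrix.mulVec_add, Matrix.mulVec_mulVec, Matrix.nonsing_inv_mul _ hdet,
        Matrix.one_mulVec]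
      abel
    have h1 : pnorm p v ≤ pnorm p (B⁻¹ *ᵥ res I (gram x *ᵥ Δ)) +
        pnorm p (B⁻¹ *ᵥ res I (gram x *ᵥ cut Iᶜ Δ)) := by
      have := pnorm_add_le (p := p) (B⁻¹ *ᵥ res I (gram x *ᵥ Δ))
        (-(B⁻¹ *ᵥ res I (gram x *ᵥ cut Iᶜ Δ)))
      rwa [← hveq, pnorm_neg] at this
    have h2 := hμle (B⁻¹ *ᵥ res I (gram x *ᵥ Δ))
    rw [Matrix.mulVec_mulVec, Matrix.mul_nonsing_inv _ hdet, Matrix.one_mulVec] at h2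
    have h3 : pnorm p (res I (gram x *ᵥ Δ)) ≤
        ((F.card : ℝ) + l) ^ (1 / p).toReal * (3 / 4 * lam) := by
      have := pnorm_le_card (p := p) (v := res I (gram x *ᵥ Δ)) (M := 3 / 4 * lam)
        (by positivity) fun i => by
          have hval : res I (gram x *ᵥ Δ) i = noise x y βbar i - lam / 2 * g i := hKKT i
          rw [hval]
          exact hr i
      rwa [Fintype.card_coe, hIc, Nat.cast_add] at this
    apply le_of_scaled_le ht hα hμpos hα16
    refine le_trans ?_ (h2.trans h3)
    gcongr
    linarith

/-! ### Euclidean estimates, positivity of μ and finiteness of ρ -/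

theorem pnorm_two {ι : Type*} [Fintype ι] (v : ι → ℝ) : pnorm 2 v = √(∑ j, v j ^ 2) := by
  have := PiLp.norm_eq_of_L2 (WithLp.toLp 2 v)
  simpa [pnorm] using this

theorem pnorm_two_sq {ι : Type*} [Fintype ι] (v : ι → ℝ) : pnorm 2 v ^ 2 = ∑ j, v j ^ 2 := by
  rw [pnorm_two, Real.sq_sqrt (Finset.sum_nonneg fun _ _ => sq_nonneg _)]

theorem pnorm_two_res {ι : Type*} [Fintype ι] {I : Finset ι} {v : ι → ℝ}
    (hv : ∀ j ∉ I, v j = 0) : pnorm 2 (res I v) = pnorm 2 v := by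
  rw [pnorm_two, pnorm_two]
  congr 1
  simp only [res]
  rw [Finset.sum_coe_sort I (fun j => v j ^ 2)]
  exact Finset.sum_subset (Finset.subset_univ _) fun j _ hj => by rw [hv j hj]; ring

theorem dotProduct_le_pnorm_two {ι : Type*} [Fintype ι] (v w : ι → ℝ) :
    v ⬝ᵥ w ≤ pnorm 2 v * pnorm 2 w := by
  rw [pnorm_two, pnorm_two]
  exact Real.sum_mul_le_sqrt_mul_sqrt _ _ _

theorem sum_abs_le_sqrt_card {ι : Type*} [Fintype ι] (F : Finset ι) (v : ι → ℝ) :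
    ∑ j ∈ F, |v j| ≤ √F.card * pnorm 2 v := by
  have h1 := sq_sum_le_card_mul_sum_sq (s := F) (f := fun j => |v j|)
  have h2 : ∑ j ∈ F, |v j| ^ 2 ≤ ∑ j, v j ^ 2 := by
    simp_rw [sq_abs]
    exact Finset.sum_le_univ_sum_of_nonneg fun j => sq_nonneg _
  rw [pnorm_two, ← Real.sqrt_mul (Nat.cast_nonneg _)]
  apply Real.le_sqrt_of_sq_le
  exact h1.trans (by gcongr)

theorem pnorm_two_cut {ι : Type*} [Fintype ι] [DecidableEq ι] (I : Finset ι) (v : ι → ℝ) :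
    pnorm 2 (cut I v) = √(∑ j ∈ I, v j ^ 2) := by
  rw [pnorm_two]
  congr 1
  simp [cut, Finset.sum_ite_mem]

section positivity

variable {n d : ℕ} {x : Fin n → Fin d → ℝ} {m : ℕ}

theorem res_ne_zero {I : Finset (Fin d)} {v : Fin d → ℝ} (hvI : ∀ j ∉ I, v j = 0) (hv : v ≠ 0) :
    res I v ≠ 0 := by
  intro h
  apply hv
  ext j
  by_cases hj : j ∈ I
  · exact congrFun h ⟨j, hj⟩
  · exact hvI j hj

/-- A null vector of the semidefinite form lies in the kernel of Â, which would make the quotient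
defining ω zero. -/
theorem quadForm_pos_of_omegaQ_pos {p : ℝ≥0∞} [Fact (1 ≤ p)] (h : 0 < omegaQ (gram x) p m)
    {I : Finset (Fin d)} (hI : I.card = m) {v : Fin d → ℝ} (hvI : ∀ j ∉ I, v j = 0) (hv : v ≠ 0) :
    0 < v ⬝ᵥ (gram x *ᵥ v) := by
  refine (gram_quadForm_nonneg x v).lt_of_ne fun h0 => ?_
  have hz := gram_mulVec_eq_zero h0.symm
  have hv' := res_ne_zero hvI hv
  obtain ⟨w, hw⟩ := exists_isSignedPow (p := p) hv'
  have h1 := omegaQ_ne_top_and_mul_le (A := gram x) hv' hw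
  rw [hI, dotProduct_block_gram_comm, block_mulVec_res _ _ _ hvI, hz,
    show res I (0 : Fin d → ℝ) = 0 from rfl, dotProduct_zero, max_self] at h1
  have := mul_pos (ENNReal.toReal_pos h.ne' h1.1) (hw.dotProduct_pos hv')
  linarith [h1.2]

theorem quadForm_pos_of_muQ_pos {p : ℝ≥0∞} [Fact (1 ≤ p)] (h : 0 < muQ (gram x) p m)
    {I : Finset (Fin d)} (hI : I.card = m) {v : Fin d → ℝ} (hvI : ∀ j ∉ I, v j = 0) (hv : v ≠ 0) :
    0 < v ⬝ᵥ (gram x *ᵥ v) := by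
  refine (gram_quadForm_nonneg x v).lt_of_ne fun h0 => ?_
  have hz := gram_mulVec_eq_zero h0.symm
  have hv' := res_ne_zero hvI hv
  have h1 := muQ_ne_top_and_mul_le (A := gram x) (p := p) hv'
  rw [hI, block_mulVec_res _ _ _ hvI, hz, show res I (0 : Fin d → ℝ) = 0 from rfl,
    pnorm_zero] at h1
  have := mul_pos (ENNReal.toReal_pos h.ne' h1.1) (pnorm_pos (p := p) hv')
  linarith [h1.2]

/-- The extension by zero of a vector indexed by `I`. -/
def extendZero {ι : Type*} [DecidableEq ι] (I : Finset ι) (v : I → ℝ) : ι → ℝ :=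
  fun j => if h : j ∈ I then v ⟨j, h⟩ else 0

theorem res_extendZero {ι : Type*} [DecidableEq ι] (I : Finset ι) (v : I → ℝ) :
    res I (extendZero I v) = v := by
  ext j
  simp [res, extendZero]

theorem extendZero_of_notMem {ι : Type*} [DecidableEq ι] {I : Finset ι} (v : I → ℝ) :
    ∀ j ∉ I, extendZero I v j = 0 := fun j hj => by simp [extendZero, hj]

/-- Each definite block is injective, hence bounded below in finite dimension, and there are only
finitely many index sets. This is what gives the division by μ in the final bound its intended
meaning, since real division by 0 yields 0. -/
theorem muQ_two_pos (h : ∀ I : Finset (Fin d), I.card = m → ∀ v : Fin d → ℝ,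
    (∀ j ∉ I, v j = 0) → v ≠ 0 → 0 < v ⬝ᵥ (gram x *ᵥ v)) : 0 < muQ (gram x) 2 m := by
  obtain ⟨I, hI⟩ := exists_eq_ciInf_of_finite (f := fun I : Finset (Fin d) =>
    ⨅ (_ : I.card = m) (v : I → ℝ) (_ : v ≠ 0),
      ENNReal.ofReal (pnorm 2 (block (gram x) I I *ᵥ v)) / ENNReal.ofReal (pnorm 2 v))
  rw [muQ, ← hI]
  by_cases hIm : I.card = m
  swap
  · simp [hIm]
  set f := Matrix.toLpLin 2 2 (block (gram x) I I) with hf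
  have hfv : ∀ v : I → ℝ, f (WithLp.toLp 2 v) = WithLp.toLp 2 (block (gram x) I I *ᵥ v) :=
    fun v => rfl
  have hker : LinearMap.ker f = ⊥ := by
    rw [LinearMap.ker_eq_bot']
    intro v hv
    by_contra hne
    have hv0 : WithLp.ofLp v ≠ 0 := fun h => hne (by ext j; exact congrFun h j)
    have h2 : block (gram x) I I *ᵥ WithLp.ofLp v = 0 := by
      have := hfv (WithLp.ofLp v)
      rw [show WithLp.toLp 2 (WithLp.ofLp v) = v from rfl, hv] at this
      exact (congrArg WithLp.ofLp this).symm
    have hext := extendZero_of_notMem (WithLp.ofLp v)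
    have h1 := h I hIm (extendZero I (WithLp.ofLp v)) hext
      (fun h0 => hv0 (by rw [← res_extendZero I (WithLp.ofLp v), h0]; rfl))
    rw [← res_dotProduct_res hext, ← block_mulVec_res _ _ _ hext, res_extendZero, h2,
      dotProduct_zero] at h1
    exact lt_irrefl _ h1
  obtain ⟨K, hK, hanti⟩ := f.exists_antilipschitzWith hker
  have hK' : (0 : ℝ) < K := by exact_mod_cast hK
  refine lt_of_lt_of_le (b := ENNReal.ofReal (K : ℝ)⁻¹) (by positivity) ?_
  refine le_iInf fun _ => le_iInf₂ fun v hv => ?_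
  have hvp := pnorm_pos (p := 2) hv
  rw [← ENNReal.ofReal_div_of_pos hvp]
  apply ENNReal.ofReal_le_ofReal
  rw [le_div_iff₀ hvp, inv_mul_le_iff₀ hK']
  have := hanti.le_mul_dist (WithLp.toLp 2 v) 0
  rwa [map_zero, dist_zero_right, dist_zero_right, hfv] at this

/-- Finitely many operator norms dominate the supremum. Finiteness matters because `toReal` sends ∞
to 0. -/
theorem rhoQ_two_ne_top : rhoQ (gram x) 2 m ≠ ∞ := by
  obtain ⟨I, hI⟩ := exists_eq_ciSup_of_finite (f := fun I : Finset (Fin d) =>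
    ⨆ (_ : I.card = m) (v : I → ℝ) (_ : v ≠ 0),
      ENNReal.ofReal (pnorm 2 (block (gram x) I I *ᵥ v)) / ENNReal.ofReal (pnorm 2 v))
  rw [rhoQ, ← hI]
  set f := (Matrix.toLpLin 2 2 (block (gram x) I I)).toContinuousLinearMap with hf
  refine ne_top_of_le_ne_top (ENNReal.ofReal_ne_top (r := ‖f‖)) ?_
  refine iSup_le fun _ => iSup₂_le fun v hv => ?_
  have hvp := pnorm_pos (p := 2) hv
  rw [← ENNReal.ofReal_div_of_pos hvp]
  apply ENNReal.ofReal_le_ofReal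
  rw [div_le_iff₀ hvp]
  exact f.le_opNorm (WithLp.toLp 2 v)

/-- For a positive semidefinite matrix, the smallest singular values bound the quadratic form. -/
theorem muQ_two_mul_sq_le {I : Finset (Fin d)} (hμ : 0 < muQ (gram x) 2 I.card) {z : Fin d → ℝ}
    (hz : ∀ j ∉ I, z j = 0) :
    (muQ (gram x) 2 I.card).toReal * pnorm 2 z ^ 2 ≤ z ⬝ᵥ (gram x *ᵥ z) := by
  rcases eq_or_ne z 0 with rfl | hz0
  · simp [pnorm_zero]
  have hμle := muQ_mul_le (A := gram x) (p := 2) (I := I)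
  have hμpos := ENNReal.toReal_pos hμ.ne'
    (muQ_ne_top_and_mul_le (A := gram x) (p := 2) (res_ne_zero hz hz0)).1
  set μ' := (muQ (gram x) 2 I.card).toReal
  set B := block (gram x) I I with hB
  have hinj : Function.Injective B.mulVec := by
    intro v v' hvv
    by_contra hne
    have h1 := hμle (v - v')
    rw [Matrix.mulVec_sub, show B *ᵥ v = B *ᵥ v' from hvv, sub_self, pnorm_zero] at h1
    have := mul_pos hμpos (pnorm_pos (p := 2) (sub_ne_zero.2 hne))
    linarith
  have hdet : IsUnit B.det :=
    (Matrix.isUnit_iff_isUnit_det B).1 (Matrix.mulVec_injective_iff_isUnit.1 hinj)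
  -- With By = z on `I`, Cauchy–Schwarz for the form gives ‖z‖⁴ ≤ (zᵀÂz)(yᵀz), and μ‖y‖ ≤ ‖z‖
  -- finishes without any eigenvalues.
  set y := B⁻¹ *ᵥ res I z with hy
  have hBy : B *ᵥ y = res I z := by
    rw [hy, Matrix.mulVec_mulVec, Matrix.mul_nonsing_inv _ hdet, Matrix.one_mulVec]
  have hext := extendZero_of_notMem y
  have hAy : res I (gram x *ᵥ extendZero I y) = res I z := by
    rw [← block_mulVec_res _ _ _ hext, res_extendZero, ← hB, hBy]
  have hCS := sq_dotProduct_gram_le x z (extendZero I y)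
  have h1 : z ⬝ᵥ (gram x *ᵥ extendZero I y) = pnorm 2 z ^ 2 := by
    rw [← res_dotProduct_res hz, hAy, res_dotProduct_res hz, pnorm_two_sq]
    exact Finset.sum_congr rfl fun j _ => (sq _).symm
  have h2 : extendZero I y ⬝ᵥ (gram x *ᵥ extendZero I y) ≤ pnorm 2 y * pnorm 2 z := by
    rw [← res_dotProduct_res hext, hAy, res_extendZero, ← pnorm_two_res hz]
    exact dotProduct_le_pnorm_two _ _
  have h3 := hμle y
  rw [hBy, pnorm_two_res hz] at h3
  rw [h1] at hCS
  have hq := gram_quadForm_nonneg x z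
  set q := z ⬝ᵥ (gram x *ᵥ z)
  have hzp := pnorm_pos (p := 2) hz0
  set Z := pnorm 2 z
  have h4 : μ' * (Z ^ 2) ^ 2 ≤ q * Z ^ 2 := by
    calc μ' * (Z ^ 2) ^ 2 ≤ μ' * (q * (pnorm 2 y * Z)) := by
          gcongr
          exact hCS.trans (by gcongr)
      _ = q * (μ' * pnorm 2 y) * Z := by ring
      _ ≤ q * Z * Z := by gcongr
      _ = _ := by ring
  refine le_of_mul_le_mul_right (a := Z ^ 2) ?_ (by positivity)
  linarith

theorem quadForm_le_rhoQ {I : Finset (Fin d)} {z : Fin d → ℝ} (hz : ∀ j ∉ I, z j = 0) :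
    z ⬝ᵥ (gram x *ᵥ z) ≤ (rhoQ (gram x) 2 I.card).toReal * pnorm 2 z ^ 2 := by
  have h1 := le_rhoQ_mul (A := gram x) (p := 2) (I := I) rhoQ_two_ne_top (res I z)
  rw [block_mulVec_res _ _ _ hz, pnorm_two_res hz] at h1
  rw [← res_dotProduct_res hz]
  refine (dotProduct_le_pnorm_two _ _).trans ?_
  rw [pnorm_two_res hz]
  have := pnorm_nonneg (p := 2) z
  nlinarith

/-- Cauchy–Schwarz separates the two vectors, so each support may have up to m elements and their
union is never formed. -/
theorem bilinForm_le_rhoQ (hm : m ≤ d) {I H : Finset (Fin d)} (hI : I.card ≤ m) (hH : H.card ≤ m)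
    {z u : Fin d → ℝ} (hz : ∀ j ∉ I, z j = 0) (hu : ∀ j ∉ H, u j = 0) :
    |z ⬝ᵥ (gram x *ᵥ u)| ≤ (rhoQ (gram x) 2 m).toReal * pnorm 2 z * pnorm 2 u := by
  have key : ∀ {I : Finset (Fin d)} {z : Fin d → ℝ}, I.card ≤ m → (∀ j ∉ I, z j = 0) →
      z ⬝ᵥ (gram x *ᵥ z) ≤ (rhoQ (gram x) 2 m).toReal * pnorm 2 z ^ 2 := by
    intro I z hI hz
    obtain ⟨I', hII', -, hI'⟩ := Finset.exists_subsuperset_card_eq (Finset.subset_univ I) hI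
      (by rwa [Finset.card_univ, Fintype.card_fin])
    rw [← hI']
    exact quadForm_le_rhoQ fun j hj => hz j fun h => hj (hII' h)
  have hρ : 0 ≤ (rhoQ (gram x) 2 m).toReal := ENNReal.toReal_nonneg
  have hz2 := pnorm_nonneg (p := 2) z
  have hu2 := pnorm_nonneg (p := 2) u
  refine abs_le_of_sq_le_sq ((sq_dotProduct_gram_le x z u).trans ?_) (by positivity)
  calc _ ≤ ((rhoQ (gram x) 2 m).toReal * pnorm 2 z ^ 2) *
        ((rhoQ (gram x) 2 m).toReal * pnorm 2 u ^ 2) :=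
        mul_le_mul (key hI hz) (key hH hu) (gram_quadForm_nonneg x u) (by positivity)
    _ = _ := by ring

end positivity

theorem signedPow_two {ι : Type*} (v : ι → ℝ) : signedPow 2 v = v := by
  ext j
  have : (2 : ℝ≥0∞).toReal - 1 = 1 := by norm_num
  rw [signedPow, this, Real.rpow_one, mul_comm]
  exact sign_mul_abs (v j)

theorem isSignedPow_two {ι : Type*} [Fintype ι] [DecidableEq ι] (v : ι → ℝ) :
    IsSignedPow 2 v v :=
  Or.inl ⟨by norm_num, (signedPow_two v).symm⟩

/-- The entries of `β` that do not exceed a level have `2`-norm at most `r_k^{(2)}(β)`, if `k` is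
the number of entries that exceed the level. -/
theorem sqrt_sum_compl_suppT_le {d : ℕ} (c : ℝ) (β : Fin d → ℝ) :
    √(∑ j ∈ (suppT c β)ᶜ, β j ^ 2) ≤ tailNorm 2 (suppT c β).card β := by
  set σ := Tuple.sort fun i => -|β i| with hσ
  rw [tailNorm, pnorm_two]
  apply Real.sqrt_le_sqrt
  have h1 : ∑ j ∈ (suppT c β)ᶜ, β j ^ 2 =
      ∑ j, if σ j ∈ (suppT c β)ᶜ then β (σ j) ^ 2 else 0 := by
    rw [Equiv.sum_comp σ fun j => if j ∈ (suppT c β)ᶜ then β j ^ 2 else 0,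
      Finset.sum_ite_mem, Finset.univ_inter]
  rw [h1]
  refine Finset.sum_le_sum fun j _ => ?_
  by_cases hj : σ j ∈ (suppT c β)ᶜ
  swap
  · rw [if_neg hj]
    positivity
  have hnot : ¬ (j : ℕ) < (suppT c β).card := by
    intro hlt
    have hmono := Tuple.monotone_sort fun i => -|β i|
    -- If position `j` holds a small entry, all entries above the level are sorted strictly before
    -- it, so their number is at most `j`.
    have hsub : (suppT c β).map σ.symm.toEmbedding ⊆ Finset.Iio j := by
      intro i hi
      obtain ⟨i', hi', rfl⟩ := Finset.mem_map.1 hi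
      rw [Finset.mem_Iio]
      by_contra! hle
      have h2 := hmono hle
      simp only [Function.comp, ← hσ, Equiv.coe_toEmbedding, Equiv.apply_symm_apply] at h2
      simp only [suppT, Finset.mem_compl, Finset.mem_filter, Finset.mem_univ, true_and] at hj hi'
      linarith
    have h3 := Finset.card_le_card hsub
    rw [Finset.card_map, Fin.card_Iio] at h3
    omega
  rw [if_pos hj, if_neg hnot]

theorem sum_abs_le_sqrt_mul_sqrt {ι : Type*} (F : Finset ι) (v : ι → ℝ) :
    ∑ j ∈ F, |v j| ≤ √F.card * √(∑ j ∈ F, v j ^ 2) := by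
  have h1 := sq_sum_le_card_mul_sum_sq (s := F) (f := fun j => |v j|)
  simp_rw [sq_abs] at h1
  rw [← Real.sqrt_mul (Nat.cast_nonneg _)]
  exact Real.le_sqrt_of_sq_le h1

/-! ### Stage two: Euclidean error -/

/-- Elementary combination of the lower and upper bounds for the test with the main block. -/
theorem le_of_quadratic_bounds {t μ' ρ V r Q X c N : ℝ} (ht : 0 < t) (hμ : 0 < μ') (hV : 0 ≤ V)
    (hr : 0 ≤ r) (hρ : 0 ≤ ρ) (hc : 0 ≤ c) (hN : 0 ≤ N)
    (hQ : μ' * V ^ 2 ≤ Q) (hX : X ≤ (1 - t / 2) * Q + 3 * ρ * V * r)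
    (hup : Q - X ≤ V * (N + c) + ρ * V * r) :
    4 * V ≤ 8 / (t * μ') * (4 * ρ * r + c + N) := by
  have h1 : t / 2 * (μ' * V ^ 2) ≤ V * (N + c + 4 * ρ * r) := by
    have := mul_le_mul_of_nonneg_left hQ (show 0 ≤ t / 2 by linarith)
    linarith
  rcases hV.eq_or_lt with h0 | hpos
  · rw [← h0, mul_zero]
    positivity
  have h2 : t / 2 * μ' * V ≤ N + c + 4 * ρ * r := by
    refine le_of_mul_le_mul_left (a := V) ?_ hpos
    linarith
  rw [div_mul_eq_mul_div, le_div_iff₀ (by positivity)]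
  linarith

set_option maxHeartbeats 1000000 in
/-- Estimation error in the `2`-norm when the unpenalized set `S` lies between `Q₀` and `F`. -/
theorem IsLassoSol.pnorm_two_sub_le {n d : ℕ} {x : Fin n → Fin d → ℝ} {y : Fin n → ℝ}
    {lam : ℝ} {S : Finset (Fin d)} {β : Fin d → ℝ} (h : IsLassoSol x y lam S β) (hlam : 0 < lam)
    {βbar : Fin d → ℝ} {F Q₀ : Finset (Fin d)} (hSF : S ⊆ F) (hQS : Q₀ ⊆ S) {e t : ℝ}
    (he : ∀ j, |noise x y βbar j| ≤ e) (ht : 0 < t) (ht' : t < 1)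
    (het : 4 * (2 - t) * e ≤ t * lam) {l : ℕ} (hl : 1 ≤ l) (hd : F.card + 2 * l ≤ d)
    (hFl : F.card ≤ l) (hsupp : (suppT 0 βbar).card ≤ l)
    (hπ : piQ (gram x) 2 (F.card + l) l ≠ ∞)
    (hπt : t ≤ 1 - (piQ (gram x) 2 (F.card + l) l).toReal * √F.card / l)
    (hμ : 0 < muQ (gram x) 2 (F.card + l)) {N₀ : ℝ}
    (hN₀ : √(∑ j ∈ Q₀, noise x y βbar j ^ 2) ≤ N₀) :
    pnorm 2 (β - βbar) ≤
      8 / (t * (muQ (gram x) 2 (F.card + l)).toReal) *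
        (4 * (rhoQ (gram x) 2 (F.card + l)).toReal * √(∑ j ∈ Fᶜ, βbar j ^ 2) +
          √((F.card : ℝ) - Q₀.card) * lam + N₀) + 4 * √(∑ j ∈ Fᶜ, βbar j ^ 2) := by
  have hl0 : (0 : ℝ) < l := by exact_mod_cast hl
  have hcone := h.cone hlam hSF he ht ht' het
  obtain ⟨g, hgS, hg1, hgβ, hKKT⟩ := h.exists_subgradient hlam βbar
  have he4 := le_quarter_of_le ht ht' hlam het
  have he0 : 0 ≤ N₀ := (Real.sqrt_nonneg _).trans hN₀
  set Δ := β - βbar with hΔ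
  set b := cut Fᶜ βbar with hb
  -- The error is measured against β̄ truncated to `F`. Off `F` this makes `D` equal to β, which
  -- restores the sign argument on `J`; the truncated part `b` costs its norm `r`.
  set D := Δ + b with hD
  set r := √(∑ j ∈ Fᶜ, βbar j ^ 2) with hr
  have hr0 : 0 ≤ r := Real.sqrt_nonneg _
  have hbr : pnorm 2 b = r := pnorm_two_cut _ _
  have hDF : ∀ j ∈ F, D j = β j - βbar j := fun j hj => by simp [hD, hΔ, hb, cut, hj]
  have hDG : ∀ j ∉ F, D j = β j := fun j hj => by simp [hD, hΔ, hb, cut, hj]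
  obtain ⟨J, hFJ, hJc, hJ, hshell⟩ := exists_shelling D hl F hd
  set I := F ∪ J with hI
  have hFI : F ⊆ I := Finset.subset_union_left
  have hIc : I.card = F.card + l := by rw [hI, Finset.card_union_of_disjoint hFJ, hJc]
  have hm : F.card + l ≤ d := by omega
  set v := cut I D with hv
  have hvI : ∀ j ∉ I, v j = 0 := fun j hj => by simp [hv, cut, hj]
  have hvin : ∀ j ∈ I, v j = D j := fun j hj => by simp [hv, cut, hj]
  set V := pnorm 2 v with hV
  have hV0 : 0 ≤ V := pnorm_nonneg v
  have hsubV : ∀ H ⊆ I, √(∑ j ∈ H, D j ^ 2) ≤ V := by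
    intro H hH
    rw [hV, hv, pnorm_two_cut]
    exact Real.sqrt_le_sqrt (Finset.sum_le_sum_of_subset_of_nonneg hH fun _ _ _ => sq_nonneg _)
  set T := ∑ j ∈ Fᶜ, |β j| with hT
  have hTD : ∑ j ∈ Fᶜ, |D j| = T :=
    Finset.sum_congr rfl fun j hj => by rw [hDG j (Finset.mem_compl.1 hj)]
  have hT0 : 0 ≤ T := Finset.sum_nonneg fun _ _ => abs_nonneg _
  set T₁ := ∑ j ∈ F, |β j - βbar j| with hT₁
  have hT₁V : T₁ ≤ √F.card * V := by
    have h1 : T₁ = ∑ j ∈ F, |D j| := Finset.sum_congr rfl fun j hj => by rw [hDF j hj]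
    rw [h1]
    exact (sum_abs_le_sqrt_mul_sqrt F D).trans (by gcongr; exact hsubV F hFI)
  set r₁ := ∑ j ∈ Fᶜ, |βbar j| with hr₁
  have hr₁r : r₁ ≤ √l * r := by
    have h1 : r₁ = ∑ j ∈ suppT 0 βbar, |b j| := by
      rw [hr₁]
      have : ∑ j ∈ Fᶜ, |βbar j| = ∑ j, |b j| := by
        rw [← Finset.sum_subset (Finset.subset_univ Fᶜ) fun j _ hj => by simp [hb, cut, hj]]
        exact Finset.sum_congr rfl fun j hj => by
          simp only [hb, cut, if_pos hj]
      rw [this]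
      refine (Finset.sum_subset (Finset.subset_univ _) fun j _ hj => ?_).symm
      have : βbar j = 0 := by simpa [suppT] using hj
      simp [hb, cut, this]
    rw [h1, ← hbr]
    refine (sum_abs_le_sqrt_card _ b).trans ?_
    have := pnorm_nonneg (p := 2) b
    gcongr
  have hr₁0 : 0 ≤ r₁ := Finset.sum_nonneg fun _ _ => abs_nonneg _
  have hT₁0 : 0 ≤ T₁ := Finset.sum_nonneg fun _ _ => abs_nonneg _
  have ht43 : 0 < 4 - 3 * t := by linarith
  set μ' := (muQ (gram x) 2 (F.card + l)).toReal with hμ'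
  set ρ := (rhoQ (gram x) 2 (F.card + l)).toReal with hρ
  set π' := (piQ (gram x) 2 (F.card + l) l).toReal with hπ'
  have hρ0 : 0 ≤ ρ := ENNReal.toReal_nonneg
  have hπ0 : 0 ≤ π' := ENNReal.toReal_nonneg
  have hμpos : 0 < μ' := by
    apply ENNReal.toReal_pos hμ.ne'
    -- Some nonzero vector on `I` is needed to rule out μ = ∞, whose real value would be 0.
    have hne : (fun _ => 1 : I → ℝ) ≠ 0 := by
      obtain ⟨i, hi⟩ := Finset.card_pos.1 (by omega : 0 < I.card)
      exact fun h0 => one_ne_zero (congrFun h0 ⟨i, hi⟩)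
    have := (muQ_ne_top_and_mul_le (A := gram x) (p := 2) hne).1
    rwa [hIc] at this
  set Q := v ⬝ᵥ (gram x *ᵥ v) with hQ
  have hQ0 : 0 ≤ Q := gram_quadForm_nonneg x v
  have hQlow : μ' * V ^ 2 ≤ Q := by
    have := muQ_two_mul_sq_le (x := x) (I := I) (by rwa [hIc]) hvI
    rwa [hIc] at this
  set X := -(v ⬝ᵥ (gram x *ᵥ cut Iᶜ D)) with hX
  have hXadd : ∀ z z' : Fin d → ℝ, -(v ⬝ᵥ (gram x *ᵥ (z + z'))) ≤
      -(v ⬝ᵥ (gram x *ᵥ z)) + -(v ⬝ᵥ (gram x *ᵥ z')) := fun z z' => by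
    rw [Matrix.mulVec_add, dotProduct_add]
    linarith
  have hXρ : X ≤ ρ * V * √l * (T / l) := by
    rw [← hTD]
    refine hshell (fun z => -(v ⬝ᵥ (gram x *ᵥ z))) _ hXadd (by positivity) ?_
    intro H z M hH hIH hz hM hzM
    have h1 := bilinForm_le_rhoQ (x := x) hm hIc.le (by omega : H.card ≤ F.card + l) hvI hz
    have h2 : pnorm 2 z ≤ √l * M := by
      rw [pnorm_two]
      apply Real.sqrt_le_iff.2 ⟨by positivity, ?_⟩
      rw [mul_pow, Real.sq_sqrt hl0.le]
      calc ∑ j, z j ^ 2 = ∑ j ∈ H, z j ^ 2 :=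
            (Finset.sum_subset (Finset.subset_univ H) fun j _ hj => by rw [hz j hj]; ring).symm
        _ ≤ ∑ _j ∈ H, M ^ 2 := Finset.sum_le_sum fun j _ => by
            rw [← sq_abs]
            exact pow_le_pow_left₀ (abs_nonneg _) (hzM j) 2
        _ = l * M ^ 2 := by rw [Finset.sum_const, hH, nsmul_eq_mul]
    calc -(v ⬝ᵥ (gram x *ᵥ z)) ≤ |v ⬝ᵥ (gram x *ᵥ z)| := neg_le_abs _
      _ ≤ ρ * V * pnorm 2 z := h1
      _ ≤ ρ * V * (√l * M) := by gcongr
      _ = _ := by ring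
  have hXπ : X * V ≤ π' * Q * (T / l) := by
    rcases hV0.eq_or_lt with h0 | hpos
    · rw [← h0, mul_zero]
      positivity
    have hres : res I v ≠ 0 := by
      intro h0
      have := pnorm_two_res hvI
      rw [h0, pnorm_zero] at this
      exact hpos.ne this
    have h2 : X ≤ π' * Q / V * (T / l) := by
      rw [← hTD]
      refine hshell (fun z => -(v ⬝ᵥ (gram x *ᵥ z))) _ hXadd (by positivity) ?_
      intro H z M hH hIH hz hM hzM
      have hz' : ∀ j ∉ H, (-z) j = 0 := fun j hj => by simp [hz j hj]
      have h1 := le_piQ_mul (A := gram x) (p := 2) (I := I) (J := H) (by rwa [hIc, hH]) hIH hres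
        (isSignedPow_two _) (res H (-z))
      rw [hIc, hH, block_mulVec_res _ _ _ hz', block_mulVec_res _ _ _ hvI,
        res_dotProduct_res hvI, res_dotProduct_res hvI, pnorm_two_res hvI, Matrix.mulVec_neg,
        dotProduct_neg, max_eq_right hQ0] at h1
      have h2 : pnorm ∞ (res H (-z)) ≤ M := pnorm_top_le hM fun j => by
        simpa [res] using hzM j
      rw [div_mul_eq_mul_div, le_div_iff₀ hpos]
      refine h1.trans ?_
      rw [mul_assoc]
      gcongr
    rw [div_mul_eq_mul_div, le_div_iff₀ hpos] at h2
    exact h2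
  set c := (4 - t) / (4 - 3 * t) with hc
  have hc0 : 0 ≤ c := div_nonneg (by linarith) ht43.le
  have hc3 : c ≤ 3 := by
    rw [hc, div_le_iff₀ ht43]
    linarith
  have hTc : T ≤ c * T₁ + c * r₁ := by
    rw [← mul_add, hc, div_mul_eq_mul_div, le_div_iff₀ ht43]
    linarith
  have hcT₁ : π' * (c * T₁ / l) ≤ (1 - t / 2) * V :=
    le_of_cone hl0 ht ht' hV0 hπ0 (by rw [hc]; field_simp; exact le_rfl) hT₁V hπt
  have hXbound : X ≤ (1 - t / 2) * Q + 3 * ρ * V * r := by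
    have hρr : ρ * V * √l * (c * r₁ / l) ≤ 3 * ρ * V * r := by
      have hs : √(l : ℝ) * √l = l := Real.mul_self_sqrt hl0.le
      rw [← mul_div_assoc, div_le_iff₀ hl0]
      calc ρ * V * √l * (c * r₁) ≤ ρ * V * √l * (3 * (√l * r)) := by gcongr
        _ = 3 * ρ * V * r * (√l * √l) := by ring
        _ = _ := by rw [hs]
    have hTl : T / l ≤ c * T₁ / l + c * r₁ / l := by
      rw [← add_div]
      gcongr
    rcases hV0.eq_or_lt with h0 | hpos
    · have h1 : X ≤ 0 := by simpa [← h0] using hXρ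
      have : 0 ≤ (1 - t / 2) * Q := mul_nonneg (by linarith) hQ0
      have : 0 ≤ 3 * ρ * V * r := by positivity
      linarith
    have h1 : π' * Q / V * (c * T₁ / l) ≤ (1 - t / 2) * Q := by
      rw [div_mul_eq_mul_div, div_le_iff₀ hpos]
      calc π' * Q * (c * T₁ / l) = Q * (π' * (c * T₁ / l)) := by ring
        _ ≤ Q * ((1 - t / 2) * V) := by gcongr
        _ = _ := by ring
    have h2 : X ≤ π' * Q / V * (T / l) := by
      rw [div_mul_eq_mul_div, le_div_iff₀ hpos]
      exact hXπ
    have hA0 : 0 ≤ c * T₁ / l := by positivity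
    have hB0 : 0 ≤ c * r₁ / l := by positivity
    refine le_trans ?_ (add_le_add h1 hρr)
    have hk1 : 0 ≤ π' * Q / V := by positivity
    have hk2 : 0 ≤ ρ * V * √l := by positivity
    -- The cross term is at most each of two slopes times a + b, where a comes from the error on `F`
    -- and b from the tail of β̄. The smaller slope serves both: min(K₁,K₂)(a+b) ≤ K₁a + K₂b, so π
    -- handles a and ρ handles b.
    rcases le_total (π' * Q / V) (ρ * V * √l) with hle | hle
    · have := mul_le_mul_of_nonneg_left hTl hk1
      have := mul_le_mul_of_nonneg_right hle hB0
      linarith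
    · have := mul_le_mul_of_nonneg_left hTl hk2
      have := mul_le_mul_of_nonneg_right hle hA0
      linarith
  have hcardQF : (Q₀.card : ℝ) ≤ F.card := by
    exact_mod_cast Finset.card_le_card (hQS.trans hSF)
  have hup : Q - X ≤ V * (N₀ + √((F.card : ℝ) - Q₀.card) * lam) + ρ * V * r := by
    have hsplit : Q - X = v ⬝ᵥ (gram x *ᵥ D) := by
      rw [← cut_add_cut_compl I D, Matrix.mulVec_add, dotProduct_add, hQ, hX]
      ring
    have hb1 : v ⬝ᵥ (gram x *ᵥ b) ≤ ρ * V * r := by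
      have hbH : ∀ j ∉ suppT 0 βbar, b j = 0 := fun j hj => by
        have : βbar j = 0 := by simpa [suppT] using hj
        simp [hb, cut, this]
      have := bilinForm_le_rhoQ (x := x) hm hIc.le
        (hsupp.trans (Nat.le_add_left l F.card)) hvI hbH
      rw [hbr] at this
      exact (le_abs_self _).trans this
    have hres : v ⬝ᵥ (gram x *ᵥ Δ) ≤ V * (N₀ + √((F.card : ℝ) - Q₀.card) * lam) := by
      have h1 : v ⬝ᵥ (gram x *ᵥ Δ) =
          (∑ j ∈ F \ Q₀, D j * (noise x y βbar j - lam / 2 * g j) +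
            ∑ j ∈ Q₀, D j * (noise x y βbar j - lam / 2 * g j)) +
            ∑ j ∈ J, D j * (noise x y βbar j - lam / 2 * g j) := by
        rw [Finset.sum_sdiff (hQS.trans hSF), ← Finset.sum_union hFJ, dotProduct,
          ← Finset.sum_subset (Finset.subset_univ I) fun j _ hj => by rw [hvI j hj, zero_mul]]
        exact Finset.sum_congr rfl fun j hj => by rw [hvin j hj, hKKT]
      have hJ0 : ∑ j ∈ J, D j * (noise x y βbar j - lam / 2 * g j) ≤ 0 := by
        refine Finset.sum_nonpos fun j hj => ?_
        have hjF : j ∉ F := fun h' => Finset.disjoint_left.1 hFJ h' hj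
        have hgj := hgβ j fun h' => hjF (hSF h')
        rw [hDG j hjF]
        have h2 : β j * noise x y βbar j ≤ |β j| * (lam / 4) := by
          calc _ ≤ |β j| * |noise x y βbar j| := by rw [← abs_mul]; exact le_abs_self _
            _ ≤ _ := by gcongr; exact (he j).trans he4
        have := abs_nonneg (β j)
        nlinarith
      have hQ₀ : ∑ j ∈ Q₀, D j * (noise x y βbar j - lam / 2 * g j) ≤ V * N₀ := by
        calc _ = ∑ j ∈ Q₀, D j * noise x y βbar j :=
              Finset.sum_congr rfl fun j hj => by rw [hgS j (hQS hj)]; ring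
          _ ≤ √(∑ j ∈ Q₀, D j ^ 2) * √(∑ j ∈ Q₀, noise x y βbar j ^ 2) :=
              Real.sum_mul_le_sqrt_mul_sqrt _ _ _
          _ ≤ V * N₀ := by
              gcongr
              exact hsubV _ ((hQS.trans hSF).trans hFI)
      have hFQ : ∑ j ∈ F \ Q₀, D j * (noise x y βbar j - lam / 2 * g j) ≤
          V * (√((F.card : ℝ) - Q₀.card) * lam) := by
        have hcard : ((F \ Q₀).card : ℝ) = (F.card : ℝ) - Q₀.card := by
          rw [Finset.card_sdiff_of_subset (hQS.trans hSF),
            Nat.cast_sub (Finset.card_le_card (hQS.trans hSF))]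
        calc _ ≤ ∑ j ∈ F \ Q₀, |D j| * lam := by
              refine Finset.sum_le_sum fun j _ => ?_
              have h2 := abs_sub (noise x y βbar j) (lam / 2 * g j)
              rw [abs_mul, abs_of_pos (by positivity : 0 < lam / 2)] at h2
              have h3 := he j
              have h4 := hg1 j
              calc _ ≤ |D j| * |noise x y βbar j - lam / 2 * g j| := by
                    rw [← abs_mul]; exact le_abs_self _
                _ ≤ |D j| * lam := by gcongr; nlinarith
          _ = (∑ j ∈ F \ Q₀, |D j|) * lam := by rw [Finset.sum_mul]
          _ ≤ (√(F \ Q₀).card * V) * lam := by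
              gcongr
              refine (sum_abs_le_sqrt_mul_sqrt _ D).trans ?_
              gcongr
              exact hsubV _ (Finset.sdiff_subset.trans hFI)
          _ = _ := by rw [hcard]; ring
      rw [h1]
      linarith
    rw [hsplit, hD, Matrix.mulVec_add, dotProduct_add]
    exact add_le_add hres hb1
  have h4V := le_of_quadratic_bounds ht hμpos hV0 hr0 hρ0
    (mul_nonneg (Real.sqrt_nonneg _) hlam.le) he0 hQlow hXbound hup
  have hTfinal : T ≤ √l * (3 * (V + r)) := by
    have hk : √(F.card : ℝ) ≤ √l := Real.sqrt_le_sqrt (by exact_mod_cast hFl)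
    have h1 : T₁ ≤ √l * V := hT₁V.trans (by gcongr)
    calc T ≤ c * T₁ + c * r₁ := hTc
      _ ≤ 3 * (√l * V) + 3 * (√l * r) := by gcongr
      _ = _ := by ring
  -- The squared norm off `I` is at most maximum times L₁ norm, hence at most T²/ℓ. With |F| ≤ ℓ
  -- this is at most (3(V+r))², so the total error is at most V + 3(V+r) + r = 4V + 4r.
  have htail : pnorm 2 (cut Iᶜ D) ≤ 3 * (V + r) := by
    rw [pnorm_two_cut]
    apply Real.sqrt_le_iff.2 ⟨by positivity, ?_⟩
    have hmax : ∀ j ∈ Iᶜ, |D j| ≤ T / l := by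
      intro j hj
      rw [le_div_iff₀ hl0]
      have h1 := Finset.card_nsmul_le_sum J (fun i => |D i|) |D j| fun i hi => hJ i hi j hj
      rw [hJc, nsmul_eq_mul] at h1
      have h2 : ∑ i ∈ J, |D i| ≤ ∑ i ∈ Fᶜ, |D i| :=
        Finset.sum_le_sum_of_subset_of_nonneg
          (fun i hi => Finset.mem_compl.2 fun h' => Finset.disjoint_left.1 hFJ h' hi)
          fun _ _ _ => abs_nonneg _
      linarith
    calc ∑ j ∈ Iᶜ, D j ^ 2 ≤ ∑ j ∈ Iᶜ, T / l * |D j| := by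
          refine Finset.sum_le_sum fun j hj => ?_
          rw [← sq_abs, sq]
          gcongr
          exact hmax j hj
      _ = T / l * ∑ j ∈ Iᶜ, |D j| := by rw [Finset.mul_sum]
      _ ≤ T / l * T := by
          gcongr
          rw [← hTD]
          exact Finset.sum_le_sum_of_subset_of_nonneg
            (Finset.compl_subset_compl.2 hFI) fun _ _ _ => abs_nonneg _
      _ = T ^ 2 / l := by ring
      _ ≤ (√l * (3 * (V + r))) ^ 2 / l := by gcongr
      _ = (3 * (V + r)) ^ 2 := by
          rw [mul_pow, Real.sq_sqrt hl0.le]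
          field_simp
  have hΔle : pnorm 2 Δ ≤ V + pnorm 2 (cut Iᶜ D) + r := by
    have h1 : Δ = (v + cut Iᶜ D) + -b := by
      rw [hv, cut_add_cut_compl, hD]
      abel
    rw [h1, ← hbr, ← pnorm_neg (p := 2) b]
    exact (pnorm_add_le _ _).trans (by gcongr; exact pnorm_add_le _ _)
  linarith

/-- If the Lasso estimate is close to `βbar` in the maximum norm, its thresholded support lies
between two level sets of `βbar`. -/
theorem suppT_subset_of_abs_sub_le {d : ℕ} {β βbar : Fin d → ℝ} {α : ℝ} (hα : 0 < α)
    (h : ∀ j, |β j - βbar j| ≤ 3 / 32 * α) {lam : ℝ} (hlam : lam ≤ 0.5 * α) :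
    suppT (1.5 * α) βbar ⊆ suppT α β ∧ suppT α β ⊆ suppT lam βbar := by
  constructor
  · intro j hj
    simp only [suppT, Finset.mem_filter, Finset.mem_univ, true_and] at hj ⊢
    have h1 := abs_sub_abs_le_abs_sub (βbar j) (β j)
    rw [abs_sub_comm] at h1
    have h2 := h j
    norm_num at hj
    linarith
  · intro j hj
    simp only [suppT, Finset.mem_filter, Finset.mem_univ, true_and] at hj ⊢
    have h1 := abs_sub_abs_le_abs_sub (β j) (βbar j)
    have h2 := h j
    norm_num at hlam
    linarith

end TwoStageLasso

/-! ### Assembly of the two stages -/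

open TwoStageLasso in
theorem theorem8p1 {Ω : Type*} [MeasurableSpace Ω] (P : Measure Ω) [IsProbabilityMeasure P]
    {n d : ℕ} (x : Fin n → Fin d → ℝ) (Y : Fin n → Ω → ℝ)
    (hYmeas : ∀ i, Measurable (Y i)) (hYindep : iIndepFun Y P)
    (σ : ℝ≥0) (hYsub : ∀ i, HasSubgaussianMGF (fun ω => Y i ω - ∫ ω', Y i ω' ∂P) (σ ^ 2) P)
    (βbar : Fin d → ℝ) (hmean : ∀ i, ∫ ω, Y i ω ∂P = βbar ⬝ᵥ x i)
    (s : ℕ) (hs : (TwoStageLasso.suppT 0 βbar).card ≤ s)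
    (lam α δ : ℝ) (hlam : 0 < lam) (hδ : 0 < δ) (hδ' : δ < 1 / 2)
    (k q : ℕ) (hk : k = (TwoStageLasso.suppT lam βbar).card)
    (hq : q = (TwoStageLasso.suppT (1.5 * α) βbar).card)
    (A : Matrix (Fin d) (Fin d) ℝ) (hA : A = TwoStageLasso.gram x)
    (a : ℝ) (ha : a = TwoStageLasso.designScale x) :
    ∃ E : Set Ω, MeasurableSet E ∧ 1 - 2 * δ < P.real E ∧
      ∀ ω ∈ E, ∀ (l : ℕ) (t : ℝ) (p : ℝ≥0∞),
        1 ≤ l → s ≤ l → (l : ℝ) ≤ ((d : ℝ) - s) / 2 → 0 < t → t < 1 → 1 ≤ p →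
        -- first condition
        (TwoStageLasso.piQ A 2 (k + l) l ≠ ∞ ∧
          t ≤ 1 - (TwoStageLasso.piQ A 2 (k + l) l).toReal * (k : ℝ) ^ (0.5 : ℝ) / l) →
        -- second condition
        (lam ≤ 0.5 * α ∧
          4 * (2 - t) * t⁻¹ * σ * a * √(2 * Real.log (2 * d / δ) / n) ≤ lam) →
        -- third condition, with two alternatives
        ((0 < TwoStageLasso.omegaQ A p (s + l) ∧ TwoStageLasso.piQ A p (s + l) l ≠ ∞ ∧
            16 * (α * (TwoStageLasso.omegaQ A p (s + l)).toReal)⁻¹ *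
              (s : ℝ) ^ (1 / p).toReal * lam ≤ t ∧
            t ≤ 1 - (TwoStageLasso.piQ A p (s + l) l).toReal *
              (s : ℝ) ^ (1 - (1 / p).toReal) / l) ∨
          (0 < TwoStageLasso.muQ A p (s + l) ∧ TwoStageLasso.gammaQ A p (s + l) l ≠ ∞ ∧
            16 * (α * (TwoStageLasso.muQ A p (s + l)).toReal)⁻¹ *
              ((s : ℝ) + l) ^ (1 / p).toReal * lam ≤ t ∧
            t ≤ 1 - (TwoStageLasso.gammaQ A p (s + l) l).toReal *
              (s : ℝ) ^ (1 - (1 / p).toReal) / l)) →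
        ∀ β₁ β₂ : Fin d → ℝ, TwoStageLasso.IsTwoStageSol x (fun i => Y i ω) lam α β₁ β₂ →
          TwoStageLasso.pnorm 2 (β₂ - βbar) ≤
            8 / (t * (TwoStageLasso.muQ A 2 (k + l)).toReal) *
              (5 * (TwoStageLasso.rhoQ A 2 (k + l)).toReal * TwoStageLasso.tailNorm 2 k βbar +
                √((k : ℝ) - q) * lam +
                a * σ * (1 + √(20 * Real.log (1 / δ))) * √((q : ℝ) / n)) +
            8 * TwoStageLasso.tailNorm 2 k βbar := by
  subst hA ha hk hq
  obtain ⟨E, hEm, hEP, hE⟩ := exists_event P x Y hYmeas hYindep σ hYsub βbar hmean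
    (suppT (1.5 * α) βbar) hδ hδ'
  refine ⟨E, hEm, hEP, fun ω hω l t p hl hsl hld ht ht' hp hπ hlamα hcond β₁ β₂ hsol => ?_⟩
  obtain ⟨hsup, hN⟩ := hE ω hω
  have hα : 0 < α := by
    have := hlamα.1
    norm_num at this
    linarith
  have : Fact (1 ≤ p) := ⟨hp⟩
  have hd : s + 2 * l ≤ d := by
    have h1 : (s : ℝ) + 2 * l ≤ d := by linarith
    exact_mod_cast h1
  have het : 4 * (2 - t) *
      (σ * designScale x * √(2 * Real.log (2 * d / δ) / n)) ≤ t * lam := by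
    have h1 := mul_le_mul_of_nonneg_left hlamα.2 ht.le
    refine le_trans (le_of_eq ?_) h1
    field_simp
  have hks : (suppT lam βbar).card ≤ s := by
    refine (Finset.card_le_card ?_).trans hs
    intro j hj
    simp only [suppT, Finset.mem_filter, Finset.mem_univ, true_and] at hj ⊢
    linarith
  -- The third condition refers to size s, so the support of β̄ is padded to exactly s elements.
  obtain ⟨F₀, hF₀, -, hF₀c⟩ := Finset.exists_subsuperset_card_eq
    (Finset.subset_univ (suppT 0 βbar)) hs (by rw [Finset.card_univ, Fintype.card_fin]; omega)
  have hF₀0 : ∀ j ∉ F₀, βbar j = 0 := fun j hj => by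
    have : j ∉ suppT 0 βbar := fun h => hj (hF₀ h)
    simpa [suppT] using this
  have hclose := hsol.1.abs_sub_le hlam hα hF₀0 hsup ht ht' het hl (by rwa [hF₀c]) hp
    (by rwa [hF₀c])
  obtain ⟨hQS, hSF⟩ := suppT_subset_of_abs_sub_le hα hclose hlamα.1
  have hquad : ∀ I : Finset (Fin d), I.card = s + l → ∀ v : Fin d → ℝ,
      (∀ j ∉ I, v j = 0) → v ≠ 0 → 0 < v ⬝ᵥ (gram x *ᵥ v) := by
    intro I hI v hvI hv
    rcases hcond with h | h
    · exact quadForm_pos_of_omegaQ_pos h.1 hI hvI hv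
    · exact quadForm_pos_of_muQ_pos h.1 hI hvI hv
  -- Either alternative of the third condition makes the form definite on supports of size s + ℓ,
  -- hence on the smaller size k + ℓ.
  have hμ : 0 < muQ (gram x) 2 ((suppT lam βbar).card + l) := by
    refine muQ_two_pos fun I hI v hvI hv => ?_
    obtain ⟨I', hII', -, hI'⟩ := Finset.exists_subsuperset_card_eq (n := s + l)
      (Finset.subset_univ I) (by omega) (by rw [Finset.card_univ, Fintype.card_fin]; omega)
    exact hquad I' hI' v (fun j hj => hvI j fun h => hj (hII' h)) hv
  have hπt := hπ.2
  rw [show (0.5 : ℝ) = 1 / 2 by norm_num, ← Real.sqrt_eq_rpow] at hπt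
  have hmain := hsol.2.pnorm_two_sub_le hlam hSF hQS hsup ht ht' het hl (by omega) (by omega)
    (hs.trans hsl) hπ.1 hπt hμ hN
  have htail := sqrt_sum_compl_suppT_le lam βbar
  have htail0 := pnorm_nonneg (p := 2) fun j : Fin d =>
    if (j : ℕ) < (suppT lam βbar).card then 0 else βbar (Tuple.sort (fun i => -|βbar i|) j)
  change 0 ≤ tailNorm 2 (suppT lam βbar).card βbar at htail0
  have hρ : 0 ≤ (rhoQ (gram x) 2 ((suppT lam βbar).card + l)).toReal := ENNReal.toReal_nonneg
  refine hmain.trans ?_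
  -- The bound just obtained has constants 4 and 4 where 5 and 8 are claimed.
  gcongr <;> norm_num
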